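/- Conventions. All orders are linear, and may be empty. $L_1+L_2$ is the ordered sum, $L_1\times L_2$ is the lexicographic product with dominant first coordinate (so $\omega\times L$ is the sum of $\omega$ copies of $L$), $\omega^*$ is the reverse of $\omega$, and $\mathbf n$ is the order with $n$ elements. $A$ is a prefix of $B$ if $B=A+C$ for some (possibly empty) $C$. The class $\mathrm{LO}_{\mathrm{fp}}$ of finitely presented linear orders is the smallest class of linear orders closed under isomorphism that contains $\mathbf 0$ and $\mathbf 1$ and is closed under $(L_1,L_2)\mapsto L_1+L_2$, $L\mapsto\omega\times L$ and $L\mapsto\omega^*\times L$. On a linear order $L$ let $\sim_0$ be equality, and for an ordinal $\alpha>0$ and $x<y$ let $x\sim_\alpha y$ (and $y\sim_\alpha x$) if for some $\beta<\alpha$ only finitely many $\sim_\beta$-classes meet $[x,y]$; also $x\sim_\alpha x$. The (Hausdorff) rank $\mathrm{rk}(L)$ is the least $\alpha$ for which there are only finitely many $\sim_\alpha$-classes, and $\infty$ if there is no such $\alpha$. A 3-signed tree is a finite rooted tree in which the children of each vertex are linearly ordered, with a sign in $\{+,-,0\}$ at each vertex, such that the sign is $0$ exactly at the root and at the leaves.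 With $\omega^{+}=\omega$, $\omega^{-}=\omega^*$, $\omega^0=\mathbf 1$, attach to a vertex with sign $s$ the order $\omega^s\times S$, where $S$ is the sum, in order, of the orders attached to its children, and $S=\mathbf 1$ if it has no children. The tree presents the order attached to its root; exceptionally, the one-vertex tree presents $\mathbf 0$. The width $\mathrm{wd}(L)$ of $L\in\mathrm{LO}_{\mathrm{fp}}$ is the least number of children of the root of a 3-signed tree that presents an order isomorphic to $L$. Lemma (Euclidean division lemma). Let $L,L'\in\mathrm{LO}_{\mathrm{fp}}$ and let $f:\omega\times L\to\omega\times L'$ be an isomorphism such that $f(\mathbf 1\times L)$ is a prefix of $\mathbf 1\times L'$, where for $n\ge 0$ we view $\mathbf n\times L$ as the initial segment of $\omega\times L$ made of the first $n$ copies of $L$, and likewise for $L'$. Then there are $k\ge 1$ and $L_1,L_2\in\mathrm{LO}_{\mathrm{fp}}$ with $$L=L_1+L_2,\qquad \mathbf 1\times L'=f(\mathbf k\times L+L_1),\qquad \omega\times(L_1+L_2)\cong\omega\times(L_2+L_1),$$ where $\mathbf k\times L+L_1$ is the initial segment of $\omega\times L$ that consists of the first $k$ copies of $L$ and the prefix $L_1$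 of the next copy (in particular $L'\cong\mathbf k\times L+L_1$). Moreover: - if $\mathrm{rk}(L_1)<\mathrm{rk}(L_2)$, then $\omega\times L_1$ is isomorphic to a prefix of $L_2$; - if $\mathrm{rk}(L_1)>\mathrm{rk}(L_2)$, then $\omega\times L_2$ is isomorphic to a prefix of $L_1$; - if $\mathrm{rk}(L_1)=\mathrm{rk}(L_2)$, then $\omega\times L_1\cong\omega\times L_2$ provided that $L_1$ and $L_2$ are both non-empty, and $\min\{\mathrm{wd}(L_1),\mathrm{wd}(L_2)\}<\min\{\mathrm{wd}(L),\mathrm{wd}(L')\}$ provided that $L$ is non-empty. -/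

import Mathlib

universe u v

/-- The class of finitely presented linear orders: the smallest class of linear orders that is
closed under isomorphism, contains the empty and the one-point order, and is closed under
sums `L₁ + L₂` and under `L ↦ ω × L` and `L ↦ ω* × L`.  In a lexicographic product `A ×ₗ L` the
first coordinate is the dominant one, so `ℕ ×ₗ L` is the sum of `ω` many copies of `L`. -/
inductive FinitelyPresentedOrder : (L : Type u) → [LinearOrder L] → Prop
  | zero : FinitelyPresentedOrder PEmpty.{u + 1}
  | one : FinitelyPresentedOrder PUnit.{u + 1}
  | sum {L₁ L₂ : Type u} [LinearOrder L₁] [LinearOrder L₂] :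
      FinitelyPresentedOrder L₁ → FinitelyPresentedOrder L₂ → FinitelyPresentedOrder (L₁ ⊕ₗ L₂)
  | omegaMul {L : Type u} [LinearOrder L] :
      FinitelyPresentedOrder L → FinitelyPresentedOrder (ℕ ×ₗ L)
  | omegaStarMul {L : Type u} [LinearOrder L] :
      FinitelyPresentedOrder L → FinitelyPresentedOrder (ℕᵒᵈ ×ₗ L)
  | iso {L L' : Type u} [LinearOrder L] [LinearOrder L'] :
      FinitelyPresentedOrder L → (L ≃o L') → FinitelyPresentedOrder L'

/-- The relation `x ∼_α y` on a linear order: `∼_0` is equality and, for `α > 0`, `x ∼_α y` when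
for some `β < α` only finitely many `∼_β`-classes meet the closed interval between `x` and `y`.
The `∼_β`-class of `z` is the set `{w | z ∼_β w}`. -/
def hausdorffRel (L : Type u) [LinearOrder L] (α : Ordinal.{u}) (x y : L) : Prop :=
  x = y ∨ ∃ β : Ordinal.{u}, ∃ _ : β < α,
    ((fun z : L => {w : L | hausdorffRel L β z w}) '' Set.uIcc x y).Finite
termination_by α

/-- The condensation `L^(α)`, as the set of `∼_α`-classes, is finite. -/
def FiniteCondensation (L : Type u) [LinearOrder L] (α : Ordinal.{u}) : Prop :=
  (Set.range fun z : L => {w : L | hausdorffRel L α z w}).Finite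

open Classical in
/-- The Hausdorff rank: the least `α` with `L^(α)` finite, and `∞` if there is none. -/
noncomputable def hausdorffRank (L : Type u) [LinearOrder L] : WithTop Ordinal.{u} :=
  if ∃ α, FiniteCondensation L α then
    ((sInf {α | FiniteCondensation L α} : Ordinal.{u}) : WithTop Ordinal.{u})
  else ⊤

/-- Finite ordered rooted trees whose vertices carry a sign in `{+, -, 0}`: a vertex is given by
its sign and the list of the subtrees at its children. -/
inductive SignedTree : Type
  | node (sign : SignType) (children : List SignedTree) : SignedTree

namespace SignedTree

/-- The sign of the root. -/
def rootSign : SignedTree → SignType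
  | node s _ => s

/-- The subtrees at the children of the root. -/
def children : SignedTree → List SignedTree
  | node _ cs => cs

/-- The sign condition at each vertex of a subtree that does not contain the root: the sign is `0`
exactly at the leaves. -/
inductive ProperSigns : SignedTree → Prop
  | node (s : SignType) (cs : List SignedTree) :
      (s = 0 ↔ cs = []) → (∀ c ∈ cs, ProperSigns c) → ProperSigns (SignedTree.node s cs)

/-- The sign `0` occurs exactly at the root and at the leaves. -/
def IsThreeSigned (T : SignedTree) : Prop :=
  T.rootSign = 0 ∧ ∀ c ∈ T.children, c.ProperSigns

end SignedTree

/-- A 3-signed tree. -/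
structure ThreeSignedTree where
  tree : SignedTree
  isThreeSigned : tree.IsThreeSigned

/-- `ω^+ = ω`, `ω^- = ω*` and `ω^0 = 1`. -/
def omegaPow : SignType → LinOrd.{0}
  | .pos => LinOrd.of ℕ
  | .neg => LinOrd.of ℕᵒᵈ
  | .zero => LinOrd.of PUnit.{1}

mutual

/-- The linear order `ω^s × (sum of the orders of the children)` attached to a vertex of sign `s`,
where the sum is read as `1` if there are no children. -/
def vertexOrder : SignedTree → LinOrd.{0}
  | .node s [] => LinOrd.of (omegaPow s ×ₗ PUnit.{1})
  | .node s (c :: cs) => LinOrd.of (omegaPow s ×ₗ (vertexOrder c ⊕ₗ forestOrder cs))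

/-- The finite sum, in the given order, of the linear orders attached to the trees of a list; the
empty sum is the empty order. -/
def forestOrder : List SignedTree → LinOrd.{0}
  | [] => LinOrd.of PEmpty.{1}
  | c :: cs => LinOrd.of (vertexOrder c ⊕ₗ forestOrder cs)

end

namespace ThreeSignedTree

/-- The number of children of the root. -/
def rootWidth (T : ThreeSignedTree) : ℕ := T.tree.children.length

open Classical in
/-- The linear order presented by a 3-signed tree; the tree with only one vertex presents `0`. -/
noncomputable def lin (T : ThreeSignedTree) : LinOrd.{0} :=
  if T.tree.children = [] then LinOrd.of PEmpty.{1} else vertexOrder T.tree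

end ThreeSignedTree

/-- The width of a (finitely presented) linear order: the least number of children of the root of
a 3-signed tree that presents it. -/
noncomputable def orderWidth (L : Type u) [LinearOrder L] : ℕ :=
  sInf {n | ∃ T : ThreeSignedTree, T.rootWidth = n ∧ Nonempty (T.lin ≃o L)}

/-- `A` is a prefix (initial segment) of `B`, for two subsets of the same linear order. -/
def IsPrefixOf {X : Type u} [LinearOrder X] (A B : Set X) : Prop :=
  A ⊆ B ∧ ∀ a ∈ A, ∀ b ∈ B, b ≤ a → b ∈ A

/-- The initial segment `k × L` of `ω × L`. -/
def firstCopies (L : Type u) (k : ℕ) : Set (ℕ ×ₗ L) :=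
  {p | (ofLex p).1 < k}

/-- The initial segment `k × L + A` of `ω × L`, where `A` is an initial segment of `L`, placed in
the copy of `L` that follows `k × L`. -/
def firstCopiesAdd {L : Type u} (k : ℕ) (A : Set L) : Set (ℕ ×ₗ L) :=
  {p | (ofLex p).1 < k ∨ ((ofLex p).1 = k ∧ (ofLex p).2 ∈ A)}

-- Write `X = ω × L`. The map `f` pulls the first copy of `L'` back to a proper lower set of `X`,
-- that is, to `k` copies of `L` and a proper prefix `L₁` of the next one; the hypothesis on `f`
-- excludes `k = 0`. Let `L₂` be the rest of `L`. Removing this lower set leaves `L₂ + X`, while `ω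
-- × L'` without its first copy is again `ω × L' ≅ X`, so `L₂ + X ≅ X`. The rotation `ω × (A + B) ≅
-- A + ω × (B + A)` then gives `ω × (L₂ + L₁) ≅ L₂ + X ≅ X`, and from this `L₁ + X ≅ X`.
--
-- Iterated absorption (`omegaMul_initialSeg_of_absorb`) makes `ω × L₁` and `ω × L₂` prefixes of
-- `X`, as are `L₁` and `L₂`. Prefixes of one order are comparable, and the rank decides which is
-- longer: a proper prefix of `ω × A` has at most the rank of `A`
-- (`FiniteCondensation.of_initialSeg_omegaMul`), whereas `ω × A` itself has a larger rank if `A` is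
-- non-empty and has a rank (`exists_not_finiteCondensation_omegaMul`).
--
-- For the widths, a finitely presented order is a finite sum of blocks `1`, `ω × S`, `ω* × S`, and
-- the width is the least number of blocks. A cut inside `ω × S` leaves on its right a block of the
-- same kind, of larger rank than the left remainder; for `ω* × S` the sides are exchanged. Hence a
-- cut into non-empty parts of equal rank gives a part with fewer blocks (`IsBlockSum.cut`,
-- `min_orderWidth_lt`). This applies to `L = L₁ + L₂`, and repeatedly to `L' ≅ k × L + L₁`.

-- Sums, rotations and prefixes of linear orders.

section OrderToolkit

variable {A : Type*} {B : Type*} {C : Type*} {D : Type*}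
  [LinearOrder A] [LinearOrder B] [LinearOrder C] [LinearOrder D]

/-- A linear order is the sum of a lower set and its complement. -/
noncomputable def lowerSetSumCompl (U : Set A) (hU : IsLowerSet U) : (U ⊕ₗ (Uᶜ : Set A)) ≃o A :=
  StrictMono.orderIsoOfSurjective
    (fun x => Sum.elim Subtype.val Subtype.val (ofLex x))
    (by
      intro x y h
      induction x using Lex.rec with | _ x
      induction y using Lex.rec with | _ y
      rcases x with ⟨x, hx⟩ | ⟨x, hx⟩ <;> rcases y with ⟨y, hy⟩ | ⟨y, hy⟩
      · simpa using h
      · exact lt_of_not_ge fun h' => hy (hU h' hx)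
      · simp at h
      · simpa using h)
    (by
      intro x
      by_cases hx : x ∈ U
      · exact ⟨toLex (.inl ⟨x, hx⟩), rfl⟩
      · exact ⟨toLex (.inr ⟨x, hx⟩), rfl⟩)

/-- The left summand of a sum, as a lower set of an isomorphic order. -/
def leftPart (e : A ⊕ₗ B ≃o C) : Set C := Set.range fun a => e (toLex (.inl a))

theorem isLowerSet_leftPart (e : A ⊕ₗ B ≃o C) : IsLowerSet (leftPart e) := by
  rintro _ y hy ⟨a, rfl⟩
  obtain ⟨x, rfl⟩ := e.surjective y
  induction x using Lex.rec with | _ x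
  rcases x with x | x
  · exact ⟨x, rfl⟩
  · simp at hy

theorem mem_compl_leftPart (e : A ⊕ₗ B ≃o C) (b : B) : e (toLex (.inr b)) ∈ (leftPart e)ᶜ := by
  rintro ⟨a, h⟩
  simpa using e.injective h

noncomputable def leftPartIso (e : A ⊕ₗ B ≃o C) : A ≃o leftPart e :=
  StrictMono.orderIsoOfSurjective (fun a => ⟨e (toLex (.inl a)), a, rfl⟩)
    (fun a b h => by simpa [← Subtype.coe_lt_coe] using h)
    (fun ⟨_, a, rfl⟩ => ⟨a, rfl⟩)

noncomputable def rightPartIso (e : A ⊕ₗ B ≃o C) : B ≃o ((leftPart e)ᶜ : Set C) :=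
  StrictMono.orderIsoOfSurjective (fun b => ⟨e (toLex (.inr b)), mem_compl_leftPart e b⟩)
    (fun a b h => by simpa [← Subtype.coe_lt_coe] using h)
    (fun ⟨y, hy⟩ => by
      obtain ⟨x, rfl⟩ := e.surjective y
      induction x using Lex.rec with | _ x
      rcases x with x | x
      · exact (hy ⟨x, rfl⟩).elim
      · exact ⟨x, rfl⟩)

/-- An order isomorphism restricts to a set and its preimage. -/
noncomputable def preimageIso (f : A ≃o B) (U : Set B) : (f ⁻¹' U) ≃o U :=
  StrictMono.orderIsoOfSurjective (fun a => ⟨f a.1, a.2⟩)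
    (fun a b h => by simpa [← Subtype.coe_lt_coe] using h)
    (fun ⟨y, hy⟩ => ⟨⟨f.symm y, by simpa using hy⟩, by simp⟩)

/-- Two decompositions of an order as a sum of two orders have a common refinement. -/
theorem sumLex_refinement {A B C D : Type u}
    [LinearOrder A] [LinearOrder B] [LinearOrder C] [LinearOrder D] (e : A ⊕ₗ B ≃o C ⊕ₗ D) :
    (∃ (M : Type u) (_ : LinearOrder M), Nonempty (A ≃o C ⊕ₗ M) ∧ Nonempty (M ⊕ₗ B ≃o D)) ∨
      ∃ (M : Type u) (_ : LinearOrder M), Nonempty (C ≃o A ⊕ₗ M) ∧ Nonempty (M ⊕ₗ D ≃o B) := by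
  -- By symmetry it suffices to treat the case that `C` lies inside the image of `A`; `M` is then
  -- the part of `A` that `e` sends into `D`.
  have key : ∀ {A B C D : Type u} [LinearOrder A] [LinearOrder B] [LinearOrder C] [LinearOrder D]
      (e : A ⊕ₗ B ≃o C ⊕ₗ D) (_ : leftPart (OrderIso.refl (C ⊕ₗ D)) ⊆ leftPart e),
      ∃ (M : Type u) (_ : LinearOrder M), Nonempty (A ≃o C ⊕ₗ M) ∧ Nonempty (M ⊕ₗ B ≃o D) := by
    intro A B C D _ _ _ _ e h
    let U : Set A := {a | e (toLex (.inl a)) ∈ leftPart (OrderIso.refl (C ⊕ₗ D))}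
    have hU : IsLowerSet U := fun a b hba ha =>
      isLowerSet_leftPart (OrderIso.refl (C ⊕ₗ D)) (by simpa using hba) ha
    refine ⟨(Uᶜ : Set A), inferInstance,
      ⟨(lowerSetSumCompl U hU).symm.trans (OrderIso.sumLexCongr ?_ (OrderIso.refl _))⟩, ⟨?_⟩⟩
    · refine OrderIso.trans ?_ (leftPartIso (OrderIso.refl (C ⊕ₗ D))).symm
      refine StrictMono.orderIsoOfSurjective (fun a => ⟨e (toLex (.inl a.1)), a.2⟩)
        (fun a b h => by simpa [← Subtype.coe_lt_coe] using h) ?_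
      rintro ⟨y, hy⟩
      obtain ⟨a, rfl⟩ := h hy
      exact ⟨⟨a, hy⟩, rfl⟩
    · refine OrderIso.trans ?_ (rightPartIso (OrderIso.refl (C ⊕ₗ D))).symm
      have hB : ∀ b : B, e (toLex (.inr b)) ∈ (leftPart (OrderIso.refl (C ⊕ₗ D)))ᶜ :=
        fun b hb => mem_compl_leftPart e b (h hb)
      refine StrictMono.orderIsoOfSurjective
        (fun x => Sum.elim
          (fun a : (Uᶜ : Set A) => (⟨e (toLex (.inl a.1)), a.2⟩ : ((leftPart _)ᶜ : Set (C ⊕ₗ D))))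
          (fun b => ⟨e (toLex (.inr b)), hB b⟩) (ofLex x)) ?_ ?_
      · intro x y hxy
        induction x using Lex.rec with | _ x
        induction y using Lex.rec with | _ y
        rcases x with x | x <;> rcases y with y | y <;>
          simp [← Subtype.coe_lt_coe] at hxy ⊢ <;> exact hxy
      · rintro ⟨y, hy⟩
        obtain ⟨x, rfl⟩ := e.surjective y
        induction x using Lex.rec with | _ x
        rcases x with x | x
        · exact ⟨toLex (.inl ⟨x, hy⟩), rfl⟩
        · exact ⟨toLex (.inr x), rfl⟩
  rcases (isLowerSet_leftPart (OrderIso.refl (C ⊕ₗ D))).total (isLowerSet_leftPart e) with h | h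
  · exact Or.inl (key e h)
  · refine Or.inr (key e.symm ?_)
    rintro _ ⟨a, rfl⟩
    obtain ⟨c, hc⟩ := h ⟨a, rfl⟩
    exact ⟨c, by simpa using congrArg e.symm hc⟩

/-- `ω × (A + B) = A + ω × (B + A)`. -/
noncomputable def omegaMulRotate (A B : Type*) [LinearOrder A] [LinearOrder B] :
    A ⊕ₗ (ℕ ×ₗ (B ⊕ₗ A)) ≃o ℕ ×ₗ (A ⊕ₗ B) :=
  StrictMono.orderIsoOfSurjective
    -- The extra `A` supplies the first half of copy `0`, so each later `A` moves from the end of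
    -- copy `n` to the start of copy `n + 1`.
    (fun x => Sum.elim (fun a => toLex (0, toLex (.inl a)))
      (fun p => Sum.elim (fun b => toLex ((ofLex p).1, toLex (.inr b)))
        (fun a => toLex ((ofLex p).1 + 1, toLex (.inl a))) (ofLex (ofLex p).2)) (ofLex x))
    (by
      intro x y h
      induction x using Lex.rec with | _ x
      induction y using Lex.rec with | _ y
      rcases x with x | x <;> rcases y with y | y
      · simpa [Prod.Lex.lt_iff] using h
      · induction y using Lex.rec with | _ y
        obtain ⟨m, y⟩ := y
        induction y using Lex.rec with | _ y
        rcases y with y | y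
        · rcases Nat.eq_zero_or_pos m with rfl | hm <;> simp [Prod.Lex.lt_iff, *]
        · simp [Prod.Lex.lt_iff]
      · simp at h
      · induction x using Lex.rec with | _ x
        induction y using Lex.rec with | _ y
        obtain ⟨n, x⟩ := x
        obtain ⟨m, y⟩ := y
        induction x using Lex.rec with | _ x
        induction y using Lex.rec with | _ y
        rcases x with x | x <;> rcases y with y | y <;>
          simp [Prod.Lex.lt_iff] at h ⊢ <;> omega)
    (by
      intro y
      induction y using Lex.rec with | _ y
      obtain ⟨m, y⟩ := y
      induction y using Lex.rec with | _ y
      rcases y with y | y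
      · rcases m with _ | m
        · exact ⟨toLex (.inl y), rfl⟩
        · exact ⟨toLex (.inr (toLex (m, toLex (.inr y)))), rfl⟩
      · exact ⟨toLex (.inr (toLex (m, toLex (.inl y)))), rfl⟩)

/-- `A + ω × A = ω × A`. -/
noncomputable def addOmegaMul (A : Type*) [LinearOrder A] : A ⊕ₗ (ℕ ×ₗ A) ≃o ℕ ×ₗ A :=
  ((OrderIso.refl A).sumLexCongr
    (Prod.Lex.prodLexCongr (OrderIso.refl ℕ) (OrderIso.emptySumLex (β := PEmpty.{1})).symm)).trans
    ((omegaMulRotate A PEmpty.{1}).trans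
      (Prod.Lex.prodLexCongr (OrderIso.refl ℕ) (OrderIso.sumLexEmpty (β := PEmpty.{1}))))

/-- `(ω × A)* = ω* × A*`. -/
noncomputable def omegaMulDual (A : Type*) [LinearOrder A] : (ℕ ×ₗ A)ᵒᵈ ≃o ℕᵒᵈ ×ₗ Aᵒᵈ :=
  StrictMono.orderIsoOfSurjective
    (fun x => toLex (OrderDual.toDual (ofLex (OrderDual.ofDual x)).1,
      OrderDual.toDual (ofLex (OrderDual.ofDual x)).2))
    (by
      intro x y h
      induction x using OrderDual.rec with | _ x
      induction y using OrderDual.rec with | _ y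
      simpa [Prod.Lex.lt_iff, eq_comm] using h)
    (fun x => ⟨OrderDual.toDual
      (toLex (OrderDual.ofDual (ofLex x).1, OrderDual.ofDual (ofLex x).2)), rfl⟩)

/-- `(ω* × A)* = ω × A*`. -/
noncomputable def omegaStarMulDual (A : Type*) [LinearOrder A] : (ℕᵒᵈ ×ₗ A)ᵒᵈ ≃o ℕ ×ₗ Aᵒᵈ :=
  StrictMono.orderIsoOfSurjective
    (fun x => toLex (OrderDual.ofDual (ofLex (OrderDual.ofDual x)).1,
      OrderDual.toDual (ofLex (OrderDual.ofDual x)).2))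
    (by
      intro x y h
      induction x using OrderDual.rec with | _ x
      induction y using OrderDual.rec with | _ y
      simpa [Prod.Lex.lt_iff, eq_comm] using h)
    (fun x => ⟨OrderDual.toDual
      (toLex (OrderDual.toDual (ofLex x).1, OrderDual.ofDual (ofLex x).2)), rfl⟩)

/-- If `A + X = X`, then `ω × A` is a prefix of `X`. -/
theorem omegaMul_initialSeg_of_absorb (e : A ⊕ₗ B ≃o B) : Nonempty ((ℕ ×ₗ A) ≤i B) := by
  -- Unfolding `B = A + B` repeatedly, `g n` is the copy of `A` that is split off at stage `n`. The
  -- copies need not exhaust `B`.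
  let g : ℕ → A → B := fun n =>
    Nat.rec (fun a => e (toLex (.inl a))) (fun _ h a => e (toLex (.inr (h a)))) n
  have hmono : ∀ n a m b, toLex (n, a) < toLex (m, b) → g n a < g m b := by
    intro n
    induction n with
    | zero =>
      rintro a (_ | m) b h
      · simpa [g, Prod.Lex.lt_iff] using h
      · simp [g]
    | succ n ih =>
      rintro a (_ | m) b h
      · simp [Prod.Lex.lt_iff] at h
      · have := ih a m b (by simpa [Prod.Lex.lt_iff] using h)
        simpa [g] using this
  have hlow : ∀ n a y, y ≤ g n a → ∃ m b, g m b = y := by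
    intro n
    induction n with
    | zero =>
      intro a y hy
      obtain ⟨x, rfl⟩ := e.surjective y
      induction x using Lex.rec with | _ x
      rcases x with x | x
      · exact ⟨0, x, rfl⟩
      · simp [g] at hy
    | succ n ih =>
      intro a y hy
      obtain ⟨x, rfl⟩ := e.surjective y
      induction x using Lex.rec with | _ x
      rcases x with x | x
      · exact ⟨0, x, rfl⟩
      · obtain ⟨m, b, h⟩ := ih a x (by simpa [g] using hy)
        exact ⟨m + 1, b, by rw [← h]⟩
  refine ⟨⟨(OrderEmbedding.ofStrictMono (fun p : ℕ ×ₗ A => g (ofLex p).1 (ofLex p).2)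
    fun p q h => hmono _ _ _ _ h).ltEmbedding, ?_⟩⟩
  intro p y hy
  obtain ⟨m, b, h⟩ := hlow _ _ y (le_of_lt hy)
  exact ⟨toLex (m, b), h⟩

/-- An initial segment whose range is contained in that of another one factors through it. -/
theorem exists_initialSeg_of_range_subset (f : A ≤i C) (g : B ≤i C)
    (h : Set.range f ⊆ Set.range g) : ∃ k : A ≤i B, ∀ a, g (k a) = f a := by
  choose k hk using fun a => h ⟨a, rfl⟩
  refine ⟨⟨(OrderEmbedding.ofStrictMono k ?_).ltEmbedding, ?_⟩, hk⟩
  · intro a b hab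
    rw [← g.lt_iff_lt, hk, hk]
    exact f.lt_iff_lt.2 hab
  · intro a b hb
    have hb' : b < k a := hb
    rw [← g.lt_iff_lt, hk] at hb'
    obtain ⟨c, hc⟩ := f.mem_range_of_le hb'.le
    exact ⟨c, g.injective ((hk c).trans hc)⟩

/-- Two initial segments of the same order are comparable. -/
theorem initialSeg_trichotomy (f : A ≤i C) (g : B ≤i C) :
    Nonempty (A ≃o B) ∨ (∃ k : A ≤i B, Set.range k ≠ Set.univ) ∨
      ∃ k : B ≤i A, Set.range k ≠ Set.univ := by
  rcases f.isLowerSet_range.total g.isLowerSet_range with h | h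
  · obtain ⟨k, -⟩ := exists_initialSeg_of_range_subset f g h
    by_cases hk : Set.range k = Set.univ
    · exact Or.inl ⟨k.strictMono.orderIsoOfSurjective k (Set.range_eq_univ.1 hk)⟩
    · exact Or.inr (Or.inl ⟨k, hk⟩)
  · obtain ⟨k, -⟩ := exists_initialSeg_of_range_subset g f h
    by_cases hk : Set.range k = Set.univ
    · exact Or.inl ⟨(k.strictMono.orderIsoOfSurjective k (Set.range_eq_univ.1 hk)).symm⟩
    · exact Or.inr (Or.inr ⟨k, hk⟩)

/-- The left summand is a prefix of the sum. -/
def sumLexInitialSeg (e : A ⊕ₗ B ≃o C) : A ≤i C :=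
  ⟨(OrderEmbedding.ofStrictMono (fun a => e (toLex (.inl a)))
    fun a b h => by simpa using h).ltEmbedding, fun _ y hy =>
      isLowerSet_leftPart e (le_of_lt hy) ⟨_, rfl⟩⟩

/-- A proper lower set of `ω × A` consists of finitely many copies of `A` and a proper lower set
of the next copy. -/
theorem exists_eq_firstCopiesAdd {U : Set (ℕ ×ₗ A)} (hU : IsLowerSet U) (h : U ≠ Set.univ) :
    ∃ (k : ℕ) (S : Set A), IsLowerSet S ∧ S ≠ Set.univ ∧ U = firstCopiesAdd k S := by
  classical
  have hex : ∃ k a, toLex (k, a) ∉ U := by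
    obtain ⟨x, hx⟩ := (Set.ne_univ_iff_exists_notMem U).1 h
    exact ⟨(ofLex x).1, (ofLex x).2, hx⟩
  -- The cut falls in the first copy that is not contained in `U`.
  obtain ⟨a, ha⟩ := Nat.find_spec hex
  refine ⟨Nat.find hex, {b | toLex (Nat.find hex, b) ∈ U}, ?_, ?_, ?_⟩
  · intro b c hcb hb
    exact hU (by simpa [Prod.Lex.le_iff] using hcb) hb
  · exact fun h' => ha (by simpa using h'.ge (Set.mem_univ a))
  · ext x
    induction x using Lex.rec with | _ x
    obtain ⟨n, b⟩ := x
    constructor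
    · intro hx
      rcases lt_trichotomy n (Nat.find hex) with hn | hn | hn
      · exact Or.inl hn
      · refine Or.inr ⟨hn, ?_⟩
        simpa [← hn] using hx
      · refine absurd (hU ?_ hx) ha
        simp [Prod.Lex.le_iff, hn]
    · rintro (hn | ⟨hn, hb⟩)
      · have := Nat.find_min hex hn
        push Not at this
        exact this b
      · simp only [ofLex_toLex] at hn
        subst hn
        exact hb

theorem isLowerSet_firstCopiesAdd (k : ℕ) {S : Set A} (hS : IsLowerSet S) :
    IsLowerSet (firstCopiesAdd k S) := by
  intro x y hyx hx
  rw [Prod.Lex.le_iff] at hyx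
  rcases hyx with h | ⟨h, h'⟩
  · rcases hx with hx | ⟨hx, -⟩
    · exact Or.inl (h.trans hx)
    · exact Or.inl (hx ▸ h)
  · rcases hx with hx | ⟨hx, hx'⟩
    · exact Or.inl (h ▸ hx)
    · exact Or.inr ⟨h.trans hx, hS h' hx'⟩

noncomputable def firstCopiesAddZero (S : Set A) : S ≃o firstCopiesAdd 0 S :=
  StrictMono.orderIsoOfSurjective
    (fun a => ⟨toLex (0, a.1), Or.inr ⟨rfl, a.2⟩⟩)
    (fun a b h => by simpa [← Subtype.coe_lt_coe, Prod.Lex.lt_iff] using h)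
    (by
      rintro ⟨x, hx | ⟨hx, hx'⟩⟩
      · exact absurd hx (Nat.not_lt_zero _)
      · exact ⟨⟨(ofLex x).2, hx'⟩, Subtype.ext (congrArg toLex (Prod.ext hx.symm rfl))⟩)

noncomputable def firstCopiesAddSucc (k : ℕ) (S : Set A) :
    A ⊕ₗ firstCopiesAdd k S ≃o firstCopiesAdd (k + 1) S :=
  StrictMono.orderIsoOfSurjective
    (fun x => Sum.elim
      (fun a => (⟨toLex (0, a), Or.inl (Nat.succ_pos k)⟩ : firstCopiesAdd (k + 1) S))
      (fun p => ⟨toLex ((ofLex p.1).1 + 1, (ofLex p.1).2), p.2.imp (fun h => Nat.succ_lt_succ h)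
        fun h => ⟨congrArg Nat.succ h.1, h.2⟩⟩) (ofLex x))
    (by
      intro x y h
      induction x using Lex.rec with | _ x
      induction y using Lex.rec with | _ y
      rcases x with x | x <;> rcases y with y | y <;>
        simp [← Subtype.coe_lt_coe, Prod.Lex.lt_iff] at h ⊢ <;> exact h)
    (by
      rintro ⟨x, hx⟩
      induction x using Lex.rec with | _ x
      obtain ⟨_ | n, a⟩ := x
      · exact ⟨toLex (.inl a), rfl⟩
      · exact ⟨toLex (.inr ⟨toLex (n, a), hx.imp (fun h => Nat.lt_of_succ_lt_succ h)
          fun h => ⟨Nat.succ_injective h.1, h.2⟩⟩), rfl⟩)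

/-- The remainder does not depend on `k`: the copies behind the one that is cut again form `ω × A`.
-/
noncomputable def firstCopiesAddCompl (k : ℕ) (S : Set A) :
    (Sᶜ : Set A) ⊕ₗ (ℕ ×ₗ A) ≃o ((firstCopiesAdd k S)ᶜ : Set (ℕ ×ₗ A)) :=
  StrictMono.orderIsoOfSurjective
    (fun x => Sum.elim
      (fun a : (Sᶜ : Set A) => (⟨toLex (k, a.1), by
        rintro (h | h)
        · exact lt_irrefl _ h
        · exact a.2 h.2⟩ : ((firstCopiesAdd k S)ᶜ : Set (ℕ ×ₗ A))))
      (fun p => ⟨toLex (k + 1 + (ofLex p).1, (ofLex p).2), by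
        rintro (h | h)
        · simp at h; omega
        · have := h.1; simp at this; omega⟩) (ofLex x))
    (by
      intro x y h
      induction x using Lex.rec with | _ x
      induction y using Lex.rec with | _ y
      rcases x with x | x <;> rcases y with y | y <;>
        simp [← Subtype.coe_lt_coe, Prod.Lex.lt_iff] at h ⊢
      · exact h
      · omega
      · exact h)
    (by
      rintro ⟨x, hx⟩
      induction x using Lex.rec with | _ x
      obtain ⟨n, a⟩ := x
      rcases lt_trichotomy n k with h | rfl | h
      · exact (hx (Or.inl h)).elim
      · exact ⟨toLex (.inl ⟨a, fun ha => hx (Or.inr ⟨rfl, ha⟩)⟩), rfl⟩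
      · refine ⟨toLex (.inr (toLex (n - (k + 1), a))), Subtype.ext ?_⟩
        simp
        omega)

end OrderToolkit

-- Hausdorff rank of convex parts, sums and multiples by `ω`.

section HausdorffRank

variable {L : Type u} {A : Type u} {B : Type u} [LinearOrder L] [LinearOrder A] [LinearOrder B]
  {α β : Ordinal.{u}}

theorem hausdorffRel_iff {x y : L} : hausdorffRel L α x y ↔ x = y ∨ ∃ β < α,
    ((fun z : L => {w : L | hausdorffRel L β z w}) '' Set.uIcc x y).Finite := by
  rw [hausdorffRel]
  simp

theorem hausdorffRel_refl (x : L) : hausdorffRel L α x x := hausdorffRel_iff.2 (Or.inl rfl)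

theorem hausdorffRel_symm {x y : L} (h : hausdorffRel L α x y) : hausdorffRel L α y x := by
  rw [hausdorffRel_iff] at h ⊢
  rwa [eq_comm, Set.uIcc_comm]

theorem hausdorffRel_mono (hαβ : α ≤ β) {x y : L} (h : hausdorffRel L α x y) :
    hausdorffRel L β x y := by
  rw [hausdorffRel_iff] at h ⊢
  exact h.imp_right fun ⟨γ, hγ, h⟩ => ⟨γ, hγ.trans_le hαβ, h⟩

/-- This direction needs only reflexivity; the converse `finite_classes_of_trans` takes transitivity
as a hypothesis, so that both are available while transitivity is being proved. -/
theorem exists_finite_representatives {s : Set L}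
    (h : ((fun z : L => {w : L | hausdorffRel L α z w}) '' s).Finite) :
    ∃ t ⊆ s, t.Finite ∧ ∀ z ∈ s, ∃ w ∈ t, hausdorffRel L α z w := by
  obtain ⟨t, hts, hbij⟩ := (Set.surjOn_image (fun z : L => {w : L | hausdorffRel L α z w}) s)
    |>.exists_bijOn_subset
  refine ⟨t, hts, hbij.finite_iff_finite.2 h, fun z hz => ?_⟩
  obtain ⟨w, hw, hwz⟩ := hbij.surjOn ⟨z, hz, rfl⟩
  refine ⟨w, hw, ?_⟩
  have : w ∈ {v | hausdorffRel L α w v} := hausdorffRel_refl w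
  simp only at hwz
  rwa [hwz] at this

theorem finite_classes_of_trans
    (htrans : ∀ x y z : L, hausdorffRel L α x y → hausdorffRel L α y z → hausdorffRel L α x z)
    {s t : Set L} (ht : t.Finite) (h : ∀ z ∈ s, ∃ w ∈ t, hausdorffRel L α z w) :
    ((fun z : L => {w : L | hausdorffRel L α z w}) '' s).Finite := by
  refine (ht.image fun z : L => {w : L | hausdorffRel L α z w}).subset ?_
  rintro _ ⟨z, hz, rfl⟩
  obtain ⟨w, hw, hzw⟩ := h z hz
  refine ⟨w, hw, Set.ext fun v => ⟨fun hv => htrans _ _ _ hzw hv, fun hv =>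
    htrans _ _ _ (hausdorffRel_symm hzw) hv⟩⟩

/-- Transfinite induction. The interval between `x` and `z` is covered by the two given ones, whose
finitely many representatives for `∼_β` and `∼_γ` also serve for `∼_(max β γ)`; this relation is
transitive by induction. -/
theorem hausdorffRel_trans {x y z : L} (hxy : hausdorffRel L α x y) (hyz : hausdorffRel L α y z) :
    hausdorffRel L α x z := by
  induction α using WellFoundedLT.induction generalizing x y z with
  | _ α ih =>
  rw [hausdorffRel_iff] at hxy hyz
  rcases hxy with rfl | ⟨β, hβ, hxy⟩
  · exact hausdorffRel_iff.2 hyz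
  rcases hyz with rfl | ⟨γ, hγ, hyz⟩
  · exact hausdorffRel_iff.2 (Or.inr ⟨β, hβ, hxy⟩)
  refine hausdorffRel_iff.2 (Or.inr ⟨max β γ, max_lt hβ hγ, ?_⟩)
  obtain ⟨s, -, hs, hs'⟩ := exists_finite_representatives hxy
  obtain ⟨t, -, ht, ht'⟩ := exists_finite_representatives hyz
  refine finite_classes_of_trans (fun _ _ _ => ih _ (max_lt hβ hγ)) (hs.union ht) fun w hw => ?_
  rcases Set.uIcc_subset_uIcc_union_uIcc hw with hw | hw
  · obtain ⟨v, hv, h⟩ := hs' w hw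
    exact ⟨v, Or.inl hv, hausdorffRel_mono (le_max_left _ _) h⟩
  · obtain ⟨v, hv, h⟩ := ht' w hw
    exact ⟨v, Or.inr hv, hausdorffRel_mono (le_max_right _ _) h⟩

theorem finite_classes_iff {s : Set L} :
    ((fun z : L => {w : L | hausdorffRel L α z w}) '' s).Finite ↔
      ∃ t ⊆ s, t.Finite ∧ ∀ z ∈ s, ∃ w ∈ t, hausdorffRel L α z w :=
  ⟨exists_finite_representatives, fun ⟨_, _, ht, h⟩ =>
    finite_classes_of_trans (fun _ _ _ => hausdorffRel_trans) ht h⟩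

theorem finiteCondensation_iff :
    FiniteCondensation L α ↔ ∃ t : Set L, t.Finite ∧ ∀ z, ∃ w ∈ t, hausdorffRel L α z w := by
  rw [FiniteCondensation, ← Set.image_univ, finite_classes_iff]
  simp

theorem FiniteCondensation.mono (hαβ : α ≤ β) (h : FiniteCondensation L α) :
    FiniteCondensation L β := by
  rw [finiteCondensation_iff] at h ⊢
  obtain ⟨t, ht, h⟩ := h
  refine ⟨t, ht, fun z => ?_⟩
  obtain ⟨w, hw, hzw⟩ := h z
  exact ⟨w, hw, hausdorffRel_mono hαβ hzw⟩

/-- The exponents with finite condensation are upward closed and an infimum of ordinals is attained.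
Comparisons of ranks thereby become statements about `FiniteCondensation`. -/
theorem hausdorffRank_le_iff : hausdorffRank L ≤ (α : WithTop Ordinal.{u}) ↔
    FiniteCondensation L α := by
  unfold hausdorffRank
  split_ifs with h
  · rw [WithTop.coe_le_coe]
    exact ⟨fun h' => (csInf_mem (s := {α | FiniteCondensation L α}) h).mono h',
      fun h' => csInf_le' h'⟩
  · simp only [top_le_iff, WithTop.coe_ne_top, false_iff]
    exact fun h' => h ⟨α, h'⟩

theorem exists_finiteCondensation_of_hausdorffRank_lt (h : hausdorffRank A < hausdorffRank B) :
    ∃ α, FiniteCondensation A α ∧ ¬ FiniteCondensation B α := by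
  obtain ⟨α, hα⟩ := WithTop.ne_top_iff_exists.1 (ne_top_of_lt h)
  refine ⟨α, hausdorffRank_le_iff.1 hα.ge, fun h' => ?_⟩
  rw [← hausdorffRank_le_iff, hα] at h'
  exact absurd h (not_lt_of_ge h')

/-- The relations `∼_α` are invariant under maps onto convex subsets that preserve or reverse the
order. -/
theorem hausdorffRel_map {g : A → B} (hg : Function.Injective g)
    (hI : ∀ x y, g '' Set.uIcc x y = Set.uIcc (g x) (g y)) {x y : A} :
    hausdorffRel B α (g x) (g y) ↔ hausdorffRel A α x y := by
  induction α using WellFoundedLT.induction generalizing x y with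
  | _ α ih =>
  rw [hausdorffRel_iff, hausdorffRel_iff (L := A), hg.eq_iff]
  refine or_congr Iff.rfl (exists_congr fun β => and_congr_right fun hβ => ?_)
  -- Representatives can be chosen inside the interval, hence in the range of `g`, and so can be
  -- pulled back.
  rw [finite_classes_iff, finite_classes_iff, ← hI]
  constructor
  · rintro ⟨t, hts, ht, h⟩
    refine ⟨g ⁻¹' t ∩ Set.uIcc x y, Set.inter_subset_right,
      (ht.preimage hg.injOn).inter_of_left _, fun z hz => ?_⟩
    obtain ⟨w, hw, hzw⟩ := h (g z) ⟨z, hz, rfl⟩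
    obtain ⟨v, hv, rfl⟩ := hts hw
    exact ⟨v, ⟨hw, hv⟩, (ih β hβ).1 hzw⟩
  · rintro ⟨t, hts, ht, h⟩
    refine ⟨g '' t, Set.image_mono hts, ht.image g, ?_⟩
    rintro _ ⟨z, hz, rfl⟩
    obtain ⟨w, hw, hzw⟩ := h z hz
    exact ⟨g w, ⟨w, hw, rfl⟩, (ih β hβ).2 hzw⟩

theorem OrderEmbedding.image_uIcc_of_ordConnected (g : A ↪o B)
    (hg : (Set.range g).OrdConnected) (x y : A) : g '' Set.uIcc x y = Set.uIcc (g x) (g y) := by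
  have key : ∀ x y, x ≤ y → g '' Set.uIcc x y = Set.uIcc (g x) (g y) := by
    intro x y h
    rw [Set.uIcc_of_le h, Set.uIcc_of_le (g.le_iff_le.2 h)]
    ext z
    constructor
    · rintro ⟨w, ⟨h1, h2⟩, rfl⟩
      exact ⟨g.le_iff_le.2 h1, g.le_iff_le.2 h2⟩
    · intro hz
      obtain ⟨w, rfl⟩ := hg.out ⟨x, rfl⟩ ⟨y, rfl⟩ hz
      exact ⟨w, ⟨g.le_iff_le.1 hz.1, g.le_iff_le.1 hz.2⟩, rfl⟩
  rcases le_total x y with h | h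
  · exact key x y h
  · rw [Set.uIcc_comm, key y x h, Set.uIcc_comm]

/-- A convex suborder has no more classes than the whole order. -/
theorem FiniteCondensation.of_convex (h : FiniteCondensation B α) {g : A → B}
    (hg : Function.Injective g) (hI : ∀ x y, g '' Set.uIcc x y = Set.uIcc (g x) (g y)) :
    FiniteCondensation A α := by
  have hfin : ((fun z : B => {w : B | hausdorffRel B α z w}) '' Set.range g).Finite :=
    Set.Finite.subset h (Set.image_subset_range _ _)
  obtain ⟨t, hts, ht, h⟩ := finite_classes_iff.1 hfin
  refine finiteCondensation_iff.2 ⟨g ⁻¹' t, ht.preimage hg.injOn, fun z => ?_⟩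
  obtain ⟨w, hw, hzw⟩ := h (g z) ⟨z, rfl⟩
  obtain ⟨v, rfl⟩ := hts hw
  exact ⟨v, hw, (hausdorffRel_map hg hI).1 hzw⟩

theorem FiniteCondensation.of_orderEmbedding (h : FiniteCondensation B α) (g : A ↪o B)
    (hg : (Set.range g).OrdConnected) : FiniteCondensation A α :=
  h.of_convex g.injective (g.image_uIcc_of_ordConnected hg)

theorem FiniteCondensation.of_orderIso (h : FiniteCondensation B α) (e : A ≃o B) :
    FiniteCondensation A α :=
  h.of_orderEmbedding e.toOrderEmbedding (by simp [e.surjective.range_eq, Set.ordConnected_univ])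

theorem FiniteCondensation.dual (h : FiniteCondensation L α) : FiniteCondensation Lᵒᵈ α :=
  h.of_convex (g := OrderDual.ofDual) OrderDual.ofDual.injective (by
    intro x y
    rw [Equiv.image_eq_preimage_symm]
    exact Set.uIcc_toDual (OrderDual.ofDual x) (OrderDual.ofDual y) ▸ rfl)

theorem FiniteCondensation.of_dual (h : FiniteCondensation Lᵒᵈ α) : FiniteCondensation L α :=
  h.dual.of_orderIso (OrderIso.dualDual L)

theorem range_inl_ordConnected : (Set.range fun a : A => (toLex (.inl a) : A ⊕ₗ B)).OrdConnected :=
  (isLowerSet_leftPart (OrderIso.refl (A ⊕ₗ B))).ordConnected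

theorem range_inr_ordConnected :
    (Set.range fun b : B => (toLex (.inr b) : A ⊕ₗ B)).OrdConnected := by
  have : (Set.range fun b : B => (toLex (.inr b) : A ⊕ₗ B)) =
      (leftPart (OrderIso.refl (A ⊕ₗ B)))ᶜ := by
    ext x
    induction x using Lex.rec with | _ x
    rcases x with x | x <;> simp [leftPart]
  rw [this]
  exact (isLowerSet_leftPart (OrderIso.refl (A ⊕ₗ B))).compl.ordConnected

def sumLexInlEmbedding (A B : Type*) [LinearOrder A] [LinearOrder B] : A ↪o A ⊕ₗ B :=
  OrderEmbedding.ofStrictMono (fun a => toLex (.inl a)) Sum.Lex.inl_strictMono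

def sumLexInrEmbedding (A B : Type*) [LinearOrder A] [LinearOrder B] : B ↪o A ⊕ₗ B :=
  OrderEmbedding.ofStrictMono (fun a => toLex (.inr a)) Sum.Lex.inr_strictMono

/-- The summands are convex, so `∼_α` on the sum restricts to `∼_α` on each of them, and
representatives can be united. -/
theorem finiteCondensation_sum_iff :
    FiniteCondensation (A ⊕ₗ B) α ↔ FiniteCondensation A α ∧ FiniteCondensation B α := by
  refine ⟨fun h => ⟨h.of_orderEmbedding (sumLexInlEmbedding A B) range_inl_ordConnected,
    h.of_orderEmbedding (sumLexInrEmbedding A B) range_inr_ordConnected⟩, fun ⟨hA, hB⟩ => ?_⟩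
  obtain ⟨s, hs, hs'⟩ := finiteCondensation_iff.1 hA
  obtain ⟨t, ht, ht'⟩ := finiteCondensation_iff.1 hB
  refine finiteCondensation_iff.2 ⟨sumLexInlEmbedding A B '' s ∪ sumLexInrEmbedding A B '' t,
    (hs.image _).union (ht.image _), fun z => ?_⟩
  induction z using Lex.rec with | _ z
  rcases z with z | z
  · obtain ⟨w, hw, h⟩ := hs' z
    exact ⟨_, Or.inl ⟨w, hw, rfl⟩, (hausdorffRel_map (sumLexInlEmbedding A B).injective
      ((sumLexInlEmbedding A B).image_uIcc_of_ordConnected range_inl_ordConnected)).2 h⟩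
  · obtain ⟨w, hw, h⟩ := ht' z
    exact ⟨_, Or.inr ⟨w, hw, rfl⟩, (hausdorffRel_map (sumLexInrEmbedding A B).injective
      ((sumLexInrEmbedding A B).image_uIcc_of_ordConnected range_inr_ordConnected)).2 h⟩

theorem finiteCondensation_of_finite [Finite L] : FiniteCondensation L α :=
  finiteCondensation_iff.2 ⟨Set.univ, Set.finite_univ, fun z => ⟨z, trivial, hausdorffRel_refl z⟩⟩

theorem FiniteCondensation.finitelyManyCopies (h : FiniteCondensation L α) (k : ℕ) {S : Set L}
    (hS : IsLowerSet S) : FiniteCondensation (firstCopiesAdd k S) α := by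
  induction k with
  | zero =>
    exact (h.of_orderEmbedding (OrderEmbedding.subtype (· ∈ S))
      (by simpa using hS.ordConnected)).of_orderIso (firstCopiesAddZero S).symm
  | succ k ih =>
    exact (finiteCondensation_sum_iff.2 ⟨h, ih⟩).of_orderIso (firstCopiesAddSucc k S).symm

/-- A proper prefix of `ω × L` has no larger rank than `L`. -/
theorem FiniteCondensation.of_initialSeg_omegaMul (h : FiniteCondensation L α)
    (g : A ≤i (ℕ ×ₗ L)) (hg : Set.range g ≠ Set.univ) : FiniteCondensation A α := by
  obtain ⟨k, S, hS, -, hgS⟩ := exists_eq_firstCopiesAdd g.isLowerSet_range hg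
  refine (h.finitelyManyCopies k hS).of_orderIso
    (StrictMono.orderIsoOfSurjective (fun a => ⟨g a, hgS ▸ ⟨a, rfl⟩⟩) ?_ ?_)
  · exact fun a b hab => g.lt_iff_lt.2 hab
  · rintro ⟨x, hx⟩
    rw [← hgS] at hx
    obtain ⟨a, rfl⟩ := hx
    exact ⟨a, rfl⟩

/-- Any two points lie in finitely many copies of `L`, which meet only finitely many `∼_α`-classes;
so all points are equivalent at `α + 1`. -/
theorem FiniteCondensation.omegaMul (h : FiniteCondensation L α) :
    FiniteCondensation (ℕ ×ₗ L) (Order.succ α) := by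
  have key : ∀ x y : ℕ ×ₗ L, hausdorffRel (ℕ ×ₗ L) (Order.succ α) x y := by
    intro x y
    refine hausdorffRel_iff.2 (Or.inr ⟨α, Order.lt_succ α, ?_⟩)
    let k := max (ofLex x).1 (ofLex y).1 + 1
    have hlow : IsLowerSet (firstCopiesAdd k (∅ : Set L)) :=
      isLowerSet_firstCopiesAdd k isLowerSet_empty
    have hsub : Set.uIcc x y ⊆ firstCopiesAdd k (∅ : Set L) := by
      refine hlow.ordConnected.uIcc_subset (Or.inl ?_) (Or.inl ?_)
      · exact Nat.lt_succ_of_le (le_max_left _ _)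
      · exact Nat.lt_succ_of_le (le_max_right _ _)
    obtain ⟨t, ht, h⟩ := finiteCondensation_iff.1 (h.finitelyManyCopies k isLowerSet_empty)
    refine finite_classes_of_trans (fun _ _ _ => hausdorffRel_trans) (ht.image Subtype.val)
      fun z hz => ?_
    obtain ⟨w, hw, hzw⟩ := h ⟨z, hsub hz⟩
    have hoc : (Set.range (OrderEmbedding.subtype (· ∈ firstCopiesAdd k (∅ : Set L)))).OrdConnected :=
      by simpa using hlow.ordConnected
    exact ⟨w, ⟨w, hw, rfl⟩, (hausdorffRel_map
      (OrderEmbedding.subtype (· ∈ firstCopiesAdd k (∅ : Set L))).injective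
      (OrderEmbedding.image_uIcc_of_ordConnected _ hoc)).2 hzw⟩
  rcases isEmpty_or_nonempty (ℕ ×ₗ L) with hE | ⟨⟨x⟩⟩
  · exact finiteCondensation_of_finite
  · exact finiteCondensation_iff.2 ⟨{x}, Set.finite_singleton x, fun z => ⟨x, rfl, key z x⟩⟩

/-- The rank of `ω × L` is larger than the rank of `L`, if `L` is non-empty and has a rank. -/
theorem exists_not_finiteCondensation_omegaMul [Nonempty L] (h : ∃ α, FiniteCondensation L α) :
    ∃ α, FiniteCondensation L α ∧ ¬ FiniteCondensation (ℕ ×ₗ L) α := by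
  let α := sInf {α | FiniteCondensation L α}
  have hα : FiniteCondensation L α := csInf_mem (s := {α | FiniteCondensation L α}) h
  refine ⟨α, hα, fun hfin => ?_⟩
  obtain ⟨a⟩ := ‹Nonempty L›
  let copy : ℕ → (L ↪o ℕ ×ₗ L) := fun n => OrderEmbedding.ofStrictMono (fun b => toLex (n, b))
    fun b c h => by simpa [Prod.Lex.lt_iff] using h
  have hcopy : ∀ n, (Set.range (copy n)).OrdConnected := by
    intro n
    refine ⟨?_⟩
    rintro _ ⟨b, rfl⟩ _ ⟨c, rfl⟩ x ⟨h1, h2⟩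
    have h1' := Prod.Lex.monotone_fst _ _ h1
    have h2' := Prod.Lex.monotone_fst _ _ h2
    exact ⟨(ofLex x).2, congrArg toLex (Prod.ext (le_antisymm h1' h2') rfl)⟩
  -- Even indices leave the whole copy `2 * i + 1` between the two points. A relation through some
  -- `β < α` would make the condensation of `L` at `β` finite, against the choice of `α`.
  have hsep : ∀ i j, i < j →
      ¬ hausdorffRel (ℕ ×ₗ L) α (toLex (2 * i, a)) (toLex (2 * j, a)) := by
    intro i j hij hrel
    rcases hausdorffRel_iff.1 hrel with h | ⟨β, hβ, h⟩
    · have := congrArg (fun x => (ofLex x).1) h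
      simp at this
      omega
    · refine notMem_of_lt_csInf' hβ (?_ : FiniteCondensation L β)
      have hsub : Set.range (copy (2 * i + 1)) ⊆
          Set.uIcc (toLex (2 * i, a)) (toLex (2 * j, a)) := by
        rintro _ ⟨b, rfl⟩
        refine Set.Icc_subset_uIcc ⟨?_, ?_⟩
        · exact Prod.Lex.le_iff.2 (Or.inl (Nat.lt_succ_self _))
        · exact Prod.Lex.le_iff.2 (Or.inl (show 2 * i + 1 < 2 * j by omega))
      obtain ⟨t, hts, ht, h⟩ := finite_classes_iff.1 (h.subset (Set.image_mono hsub))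
      refine finiteCondensation_iff.2 ⟨copy (2 * i + 1) ⁻¹' t,
        ht.preimage (copy (2 * i + 1)).injective.injOn, fun z => ?_⟩
      obtain ⟨w, hw, hzw⟩ := h _ ⟨z, rfl⟩
      obtain ⟨v, rfl⟩ := hts hw
      exact ⟨v, hw, (hausdorffRel_map (copy (2 * i + 1)).injective
        ((copy (2 * i + 1)).image_uIcc_of_ordConnected (hcopy _))).1 hzw⟩
  have hinj : Function.Injective fun i : ℕ =>
      {w | hausdorffRel (ℕ ×ₗ L) α (toLex (2 * i, a)) w} := by
    intro i j hij
    have hrel : hausdorffRel (ℕ ×ₗ L) α (toLex (2 * i, a)) (toLex (2 * j, a)) := by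
      exact (show {w | hausdorffRel (ℕ ×ₗ L) α (toLex (2 * i, a)) w} =
        {w | hausdorffRel (ℕ ×ₗ L) α (toLex (2 * j, a)) w} from hij).ge (hausdorffRel_refl _)
    rcases lt_trichotomy i j with h | h | h
    · exact (hsep i j h hrel).elim
    · exact h
    · exact (hsep j i h (hausdorffRel_symm hrel)).elim
  refine Set.infinite_range_of_injective hinj (Set.Finite.subset hfin ?_)
  rintro _ ⟨i, rfl⟩
  exact ⟨_, rfl⟩

end HausdorffRank

-- Closure of finitely presented orders under reversal and cuts.

section FinitelyPresented

theorem FinitelyPresentedOrder.of_isEmpty (L : Type u) [LinearOrder L] [IsEmpty L] :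
    FinitelyPresentedOrder L :=
  .iso .zero (Equiv.equivOfIsEmpty PEmpty.{u + 1} L |>.toOrderIso
    (fun x => x.elim) (fun x => isEmptyElim x))

theorem FinitelyPresentedOrder.of_subsingleton (L : Type u) [LinearOrder L] [Subsingleton L] :
    FinitelyPresentedOrder L := by
  rcases isEmpty_or_nonempty L with h | ⟨⟨x⟩⟩
  · exact .of_isEmpty L
  · have : Unique L := ⟨⟨x⟩, fun y => Subsingleton.elim _ _⟩
    exact .iso .one (OrderIso.ofUnique PUnit.{u + 1} L)

theorem FinitelyPresentedOrder.dual {L : Type u} [LinearOrder L] (h : FinitelyPresentedOrder L) :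
    FinitelyPresentedOrder Lᵒᵈ := by
  induction h with
  | zero =>
    have : IsEmpty PEmpty.{u + 1}ᵒᵈ := inferInstanceAs (IsEmpty PEmpty)
    exact .of_isEmpty _
  | one =>
    have : Subsingleton PUnit.{u + 1}ᵒᵈ := inferInstanceAs (Subsingleton PUnit)
    exact .of_subsingleton _
  | sum _ _ ih₁ ih₂ => exact .iso (.sum ih₂ ih₁) (OrderIso.sumLexDualAntidistrib _ _).symm
  | omegaMul _ ih => exact .iso (.omegaStarMul ih) (omegaMulDual _).symm
  | omegaStarMul _ ih => exact .iso (.omegaMul ih) (omegaStarMulDual _).symm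
  | iso _ e ih => exact .iso ih e.dual

theorem FinitelyPresentedOrder.of_dual {L : Type u} [LinearOrder L]
    (h : FinitelyPresentedOrder Lᵒᵈ) : FinitelyPresentedOrder L :=
  .iso h.dual (OrderIso.dualDual L).symm

theorem FinitelyPresentedOrder.exists_finiteCondensation {L : Type u} [LinearOrder L]
    (h : FinitelyPresentedOrder L) : ∃ α, FiniteCondensation L α := by
  induction h with
  | zero => exact ⟨0, finiteCondensation_of_finite⟩
  | one => exact ⟨0, finiteCondensation_of_finite⟩
  | sum _ _ ih₁ ih₂ =>
    obtain ⟨α, hα⟩ := ih₁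
    obtain ⟨β, hβ⟩ := ih₂
    exact ⟨max α β, finiteCondensation_sum_iff.2
      ⟨hα.mono (le_max_left _ _), hβ.mono (le_max_right _ _)⟩⟩
  | omegaMul _ ih => exact ih.imp' _ fun α hα => hα.omegaMul
  | omegaStarMul _ ih =>
    obtain ⟨α, hα⟩ := ih
    exact ⟨_, (hα.dual.omegaMul.of_orderIso (omegaStarMulDual _)).of_dual⟩
  | iso _ e ih => exact ih.imp fun α hα => hα.of_orderIso e.symm

/-- The shape of a proper cut of `ω × S`. -/
theorem exists_of_sumLex_iso_omegaMul {S A B : Type u} [LinearOrder S] [LinearOrder A]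
    [LinearOrder B] (e : A ⊕ₗ B ≃o ℕ ×ₗ S) [Nonempty B] :
    ∃ (k : ℕ) (T : Set S), IsLowerSet T ∧ Nonempty (A ≃o firstCopiesAdd k T) ∧
      Nonempty (B ≃o (Tᶜ : Set S) ⊕ₗ (ℕ ×ₗ S)) ∧
      Nonempty (B ≃o ℕ ×ₗ ((Tᶜ : Set S) ⊕ₗ T)) := by
  obtain ⟨b⟩ := ‹Nonempty B›
  obtain ⟨k, T, hT, -, h⟩ := exists_eq_firstCopiesAdd (isLowerSet_leftPart e)
    fun h => mem_compl_leftPart e b (h ▸ trivial)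
  have e₁ : B ≃o (Tᶜ : Set S) ⊕ₗ (ℕ ×ₗ S) := ((rightPartIso e).trans
    (OrderIso.setCongr _ _ (congrArg _ h))).trans (firstCopiesAddCompl k T).symm
  -- For the last description of `B`, every copy of `S` is split at `T` and the pieces are regrouped
  -- by rotation.
  exact ⟨k, T, hT, ⟨(leftPartIso e).trans (OrderIso.setCongr _ _ h)⟩, ⟨e₁⟩,
    ⟨e₁.trans (((OrderIso.refl _).sumLexCongr (Prod.Lex.prodLexCongr (OrderIso.refl ℕ)
      (lowerSetSumCompl T hT).symm)).trans (omegaMulRotate _ _))⟩⟩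

theorem FinitelyPresentedOrder.firstCopiesAdd {S : Type u} [LinearOrder S]
    (hS : FinitelyPresentedOrder S) {T : Set S} (hT : FinitelyPresentedOrder T) (k : ℕ) :
    FinitelyPresentedOrder (firstCopiesAdd k T) := by
  induction k with
  | zero => exact .iso hT (firstCopiesAddZero T)
  | succ k ih => exact .iso (.sum hS ih) (firstCopiesAddSucc k T)

/-- Both parts of a cut of a finitely presented order are finitely presented. -/
theorem FinitelyPresentedOrder.cut {L : Type u} [LinearOrder L] (h : FinitelyPresentedOrder L) :
    ∀ {A B : Type u} [LinearOrder A] [LinearOrder B], (A ⊕ₗ B ≃o L) →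
      FinitelyPresentedOrder A ∧ FinitelyPresentedOrder B := by
  -- The case of `ω` is isolated because `ω*` is reduced to it by reversal.
  have omega : ∀ {S : Type u} [LinearOrder S], FinitelyPresentedOrder S →
      (∀ {A B : Type u} [LinearOrder A] [LinearOrder B], (A ⊕ₗ B ≃o S) →
        FinitelyPresentedOrder A ∧ FinitelyPresentedOrder B) →
      ∀ {A B : Type u} [LinearOrder A] [LinearOrder B], (A ⊕ₗ B ≃o ℕ ×ₗ S) →
        FinitelyPresentedOrder A ∧ FinitelyPresentedOrder B := by
    intro S _ hS ih A B _ _ e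
    rcases isEmpty_or_nonempty B with hB | hB
    · exact ⟨.iso (.omegaMul hS) (e.symm.trans OrderIso.sumLexEmpty), .of_isEmpty B⟩
    · obtain ⟨k, T, hT, ⟨e₁⟩, ⟨e₂⟩, -⟩ := exists_of_sumLex_iso_omegaMul e
      obtain ⟨h₁, h₂⟩ := ih (lowerSetSumCompl T hT)
      exact ⟨.iso (hS.firstCopiesAdd h₁ k) e₁.symm, .iso (.sum h₂ (.omegaMul hS)) e₂.symm⟩
  induction h with
  | zero =>
    intro A B _ _ e
    have : IsEmpty A := ⟨fun a => (e (toLex (.inl a))).elim⟩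
    have : IsEmpty B := ⟨fun b => (e (toLex (.inr b))).elim⟩
    exact ⟨.of_isEmpty A, .of_isEmpty B⟩
  | one =>
    intro A B _ _ e
    have : Subsingleton (A ⊕ₗ B) := e.toEquiv.subsingleton
    have : Subsingleton A := (sumLexInlEmbedding A B).injective.subsingleton
    have : Subsingleton B := (sumLexInrEmbedding A B).injective.subsingleton
    exact ⟨.of_subsingleton A, .of_subsingleton B⟩
  | sum h₁ h₂ ih₁ ih₂ =>
    intro A B _ _ e
    rcases sumLex_refinement e with ⟨M, _, ⟨f⟩, ⟨g⟩⟩ | ⟨M, _, ⟨f⟩, ⟨g⟩⟩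
    · obtain ⟨hM, hB⟩ := ih₂ g
      exact ⟨.iso (.sum h₁ hM) f.symm, hB⟩
    · obtain ⟨hA, hM⟩ := ih₁ f.symm
      exact ⟨hA, .iso (.sum hM h₂) g⟩
  | omegaMul hS ih => exact omega hS ih
  | omegaStarMul hS ih =>
    intro A B _ _ e
    obtain ⟨hB, hA⟩ := omega hS.dual (fun {C D} _ _ f => by
      obtain ⟨h₁, h₂⟩ := ih (((OrderIso.sumLexDualAntidistrib C D).symm.trans f.dual).trans
        (OrderIso.dualDual _).symm)
      exact ⟨h₂.of_dual, h₁.of_dual⟩)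
      ((OrderIso.sumLexDualAntidistrib A B).symm.trans (e.dual.trans (omegaStarMulDual _)))
    exact ⟨hA.of_dual, hB.of_dual⟩
  | iso _ e ih => exact fun f => ih (f.trans e.symm)

/-- Trees present orders in the lowest universe; lifting allows them to serve as blocks in any
universe. -/
theorem FinitelyPresentedOrder.ulift {L : Type v} [LinearOrder L] (h : FinitelyPresentedOrder L) :
    FinitelyPresentedOrder (ULift.{u} L) := by
  induction h with
  | zero => exact .of_isEmpty _
  | one => exact .of_subsingleton _
  | sum _ _ ih₁ ih₂ =>
    exact .iso (.sum ih₁ ih₂) ((OrderIso.sumLexCongr ULift.orderIso ULift.orderIso).trans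
      ULift.orderIso.symm)
  | omegaMul _ ih =>
    exact .iso (.omegaMul ih) ((Prod.Lex.prodLexCongr (OrderIso.refl _) ULift.orderIso).trans
      ULift.orderIso.symm)
  | omegaStarMul _ ih =>
    exact .iso (.omegaStarMul ih) ((Prod.Lex.prodLexCongr (OrderIso.refl _) ULift.orderIso).trans
      ULift.orderIso.symm)
  | iso _ e ih => exact .iso ih ((ULift.orderIso.trans e).trans ULift.orderIso.symm)

end FinitelyPresented

-- Cutting sums of blocks.

section Width

/-- The orders attached to the children of the root of a 3-signed tree: `1`, `ω × S` and `ω* × S`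
with `S` non-empty and finitely presented. -/
def IsBlock (L : Type u) [LinearOrder L] : Prop :=
  Nonempty (L ≃o PUnit.{u + 1}) ∨ ∃ (S : Type u) (_ : LinearOrder S),
    FinitelyPresentedOrder S ∧ Nonempty S ∧ (Nonempty (L ≃o ℕ ×ₗ S) ∨ Nonempty (L ≃o ℕᵒᵈ ×ₗ S))

/-- A sum of `n` blocks. -/
inductive IsBlockSum : ℕ → (L : Type u) → [LinearOrder L] → Prop
  | zero (L : Type u) [LinearOrder L] [IsEmpty L] : IsBlockSum 0 L
  | succ {n : ℕ} {A B L : Type u} [LinearOrder A] [LinearOrder B] [LinearOrder L] :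
      IsBlock A → IsBlockSum n B → (A ⊕ₗ B ≃o L) → IsBlockSum (n + 1) L

theorem IsBlockSum.iso {n : ℕ} {L L' : Type u} [LinearOrder L] [LinearOrder L']
    (h : IsBlockSum n L) (e : L ≃o L') : IsBlockSum n L' := by
  cases h with
  | zero =>
    have : IsEmpty L' := e.symm.toEquiv.isEmpty
    exact .zero L'
  | succ hA hB f => exact .succ hA hB (f.trans e)

theorem IsBlock.isBlockSum {L : Type u} [LinearOrder L] (h : IsBlock L) : IsBlockSum 1 L :=
  .succ h (.zero PEmpty.{u + 1}) OrderIso.sumLexEmpty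

theorem IsBlockSum.pos {n : ℕ} {L : Type u} [LinearOrder L] [hL : Nonempty L]
    (h : IsBlockSum n L) : 0 < n := by
  cases h with
  | zero => exact (not_isEmpty_of_nonempty L ‹_›).elim
  | succ => exact Nat.succ_pos _

theorem not_finiteCondensation_of_contains {A S : Type u} [LinearOrder A] [LinearOrder S]
    {T : Type u} [LinearOrder T] {α : Ordinal.{u}} (h : ¬ FiniteCondensation S α)
    (e : A ≃o T ⊕ₗ S) : ¬ FiniteCondensation A α :=
  fun hA => h (finiteCondensation_sum_iff.1 (hA.of_orderIso e.symm)).2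

/-- A proper cut of `ω × S`: the right part is again of this form, and of larger rank than the
left part. -/
theorem omegaMul_cut {S A B : Type u} [LinearOrder S] [LinearOrder A] [LinearOrder B]
    [Nonempty S] (hS : FinitelyPresentedOrder S) (e : A ⊕ₗ B ≃o ℕ ×ₗ S) [Nonempty B] :
    (∃ (S' : Type u) (_ : LinearOrder S'), FinitelyPresentedOrder S' ∧ Nonempty S' ∧
      Nonempty (B ≃o ℕ ×ₗ S')) ∧ ∃ α, FiniteCondensation A α ∧ ¬ FiniteCondensation B α := by
  obtain ⟨k, T, hT, ⟨e₁⟩, ⟨e₂⟩, ⟨e₃⟩⟩ := exists_of_sumLex_iso_omegaMul e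
  obtain ⟨h₁, h₂⟩ := hS.cut (lowerSetSumCompl T hT)
  -- This `α` separates the two sides: `A` consists of finitely many copies of `S` and a prefix of
  -- `S`, whereas `B` still contains a tail `ω × S`.
  obtain ⟨α, hα, hα'⟩ := exists_not_finiteCondensation_omegaMul hS.exists_finiteCondensation
  refine ⟨⟨_, inferInstance, .sum h₂ h₁, ?_, ⟨e₃⟩⟩, α,
    (hα.finitelyManyCopies k hT).of_orderIso e₁, not_finiteCondensation_of_contains hα' e₂⟩
  obtain ⟨b⟩ := ‹Nonempty B›
  exact ⟨(ofLex (e₃ b)).2⟩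

/-- A proper cut of `ω* × S`: the left part is again of this form, and of larger rank than the
right part. -/
theorem omegaStarMul_cut {S A B : Type u} [LinearOrder S] [LinearOrder A] [LinearOrder B]
    [Nonempty S] (hS : FinitelyPresentedOrder S) (e : A ⊕ₗ B ≃o ℕᵒᵈ ×ₗ S) [Nonempty A] :
    (∃ (S' : Type u) (_ : LinearOrder S'), FinitelyPresentedOrder S' ∧ Nonempty S' ∧
      Nonempty (A ≃o ℕᵒᵈ ×ₗ S')) ∧ ∃ α, FiniteCondensation B α ∧ ¬ FiniteCondensation A α := by
  have : Nonempty Sᵒᵈ := ‹Nonempty S›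
  have : Nonempty Aᵒᵈ := ‹Nonempty A›
  obtain ⟨⟨S', _, hS', hne, ⟨f⟩⟩, α, hα, hα'⟩ := omegaMul_cut hS.dual
    ((OrderIso.sumLexDualAntidistrib A B).symm.trans (e.dual.trans (omegaStarMulDual S)))
  exact ⟨⟨S'ᵒᵈ, inferInstance, hS'.dual, hne,
    ⟨(OrderIso.dualDual A).trans (f.dual.trans (omegaMulDual S'))⟩⟩,
    α, hα.of_dual, fun h => hα' h.dual⟩

/-- A proper cut of a sum of `n` blocks gives a sum of at most `n` blocks on one of its sides, and
of less than `n` blocks unless this side has the larger rank. -/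
theorem IsBlockSum.cut {n : ℕ} {L : Type u} [LinearOrder L] (h : IsBlockSum n L) :
    ∀ {A B : Type u} [LinearOrder A] [LinearOrder B] [Nonempty A] [Nonempty B], (A ⊕ₗ B ≃o L) →
      (∃ q ≤ n, IsBlockSum q B ∧
        (q < n ∨ ∃ α, FiniteCondensation A α ∧ ¬ FiniteCondensation B α)) ∨
      ∃ p ≤ n, IsBlockSum p A ∧
        (p < n ∨ ∃ α, FiniteCondensation B α ∧ ¬ FiniteCondensation A α) := by
  induction h with
  | zero L =>
    intro A B _ _ hA _ e
    exact isEmptyElim (e (toLex (.inl hA.some)))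
  | @succ n C D L _ _ _ hC hD f ih =>
    intro A B _ _ hA hB e
    -- Either the cut lies at or behind the end of the first block `C`, with `A = C + M`, or `C = A
    -- + M` and it lies in `C` or at its end.
    rcases sumLex_refinement (e.trans f.symm) with ⟨M, _, ⟨g₁⟩, ⟨g₂⟩⟩ | ⟨M, _, ⟨g₁⟩, ⟨g₂⟩⟩
    · rcases isEmpty_or_nonempty M with hM | hM
      · exact Or.inl ⟨n, n.le_succ, hD.iso (g₂.symm.trans OrderIso.emptySumLex),
          Or.inl n.lt_succ_self⟩
      · rcases ih g₂ with ⟨q, hq, h, -⟩ | ⟨p, hp, h, h'⟩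
        · exact Or.inl ⟨q, hq.trans n.le_succ, h, Or.inl (Nat.lt_succ_of_le hq)⟩
        · refine Or.inr ⟨p + 1, Nat.succ_le_succ hp, .succ hC h g₁.symm,
            h'.imp Nat.succ_lt_succ ?_⟩
          exact fun ⟨α, hα, hα'⟩ => ⟨α, hα, not_finiteCondensation_of_contains hα' g₁⟩
    · rcases isEmpty_or_nonempty M with hM | hM
      · exact Or.inl ⟨n, n.le_succ, hD.iso (OrderIso.emptySumLex.symm.trans g₂),
          Or.inl n.lt_succ_self⟩
      rcases hC with ⟨⟨c⟩⟩ | ⟨S, _, hS, hSne, ⟨⟨c⟩⟩ | ⟨⟨c⟩⟩⟩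
      · have := (c.symm.trans g₁).symm.injective.eq_iff.1 (Subsingleton.elim
          ((c.symm.trans g₁).symm (toLex (.inl hA.some)))
          ((c.symm.trans g₁).symm (toLex (.inr hM.some))))
        simp at this
      -- The remainder `M` replaces `C` as a block, so `B` has no fewer blocks than `L`, but it
      -- outranks `A`.
      · obtain ⟨⟨S', _, hS', hne, ⟨c'⟩⟩, α, hα, hα'⟩ := omegaMul_cut hS (g₁.symm.trans c)
        refine Or.inl ⟨n + 1, le_rfl, .succ (Or.inr ⟨S', _, hS', hne, Or.inl ⟨c'⟩⟩) hD g₂,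
          Or.inr ⟨α, hα, fun h => hα' (finiteCondensation_sum_iff.1 (h.of_orderIso g₂)).1⟩⟩
      -- Here `A` is a single block. This is fewer than `n + 1` unless `D` is empty, in which case
      -- `B` is just `M` and `A` outranks it.
      · obtain ⟨⟨S', _, hS', hne, ⟨c'⟩⟩, α, hα, hα'⟩ := omegaStarMul_cut hS (g₁.symm.trans c)
        refine Or.inr ⟨1, by omega,
          IsBlock.isBlockSum (Or.inr ⟨S', _, hS', hne, Or.inr ⟨c'⟩⟩), ?_⟩
        rcases isEmpty_or_nonempty D with hDe | hDne
        · exact Or.inr ⟨α, hα.of_orderIso (g₂.symm.trans OrderIso.sumLexEmpty), hα'⟩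
        · exact Or.inl (Nat.succ_lt_succ hD.pos)

end Width

-- From signed trees to sums of blocks, and bounds on the width.

section Trees

open SignedTree

def LinOrd.orderIsoOfEq {X Y : LinOrd.{u}} (h : X = Y) : X ≃o Y := h ▸ OrderIso.refl X

def forestOrderNil : forestOrder [] ≃o PEmpty.{1} := OrderIso.refl _

def forestOrderCons (c : SignedTree) (cs : List SignedTree) :
    forestOrder (c :: cs) ≃o vertexOrder c ⊕ₗ forestOrder cs := OrderIso.refl _

instance isEmpty_forestOrder_nil : IsEmpty (forestOrder []) := forestOrderNil.toEquiv.isEmpty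

def vertexOrderNode (s : SignType) (c : SignedTree) (cs : List SignedTree) :
    vertexOrder (.node s (c :: cs)) ≃o omegaPow s ×ₗ forestOrder (c :: cs) := OrderIso.refl _

def vertexOrderLeaf : vertexOrder (.node 0 []) ≃o PUnit.{1} :=
  Prod.Lex.uniqueProd PUnit.{1} PUnit.{1}

theorem finitelyPresentedOrder_forestOrder {cs : List SignedTree}
    (h : ∀ c ∈ cs, FinitelyPresentedOrder (vertexOrder c)) :
    FinitelyPresentedOrder (forestOrder cs) := by
  induction cs with
  | nil => exact .iso .zero forestOrderNil.symm
  | cons c cs ih =>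
    rw [List.forall_mem_cons] at h
    exact .iso (.sum h.1 (ih h.2)) (forestOrderCons c cs).symm

theorem nonempty_vertexOrder_and_finitelyPresented {c : SignedTree} (hc : c.ProperSigns) :
    Nonempty (vertexOrder c) ∧ FinitelyPresentedOrder (vertexOrder c) := by
  induction hc with
  | node s cs hs _ ih =>
    cases cs with
    | nil =>
      obtain rfl : s = 0 := hs.2 rfl
      have e := vertexOrderLeaf
      exact ⟨⟨e.symm PUnit.unit⟩, .iso .one e.symm⟩
    | cons c cs =>
      have e := vertexOrderNode s c cs
      have hF := finitelyPresentedOrder_forestOrder fun d hd => (ih d hd).2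
      obtain ⟨x⟩ := (ih c List.mem_cons_self).1
      have hne : Nonempty (forestOrder (c :: cs)) :=
        ⟨(forestOrderCons c cs).symm (toLex (.inl x))⟩
      obtain ⟨y⟩ := hne
      cases s with
      | zero => exact absurd (hs.1 rfl) (by simp)
      | pos => exact ⟨⟨e.symm (toLex ((0 : ℕ), y))⟩, .iso (.omegaMul hF) e.symm⟩
      | neg => exact ⟨⟨e.symm (toLex (OrderDual.toDual (0 : ℕ), y))⟩,
          .iso (.omegaStarMul hF) e.symm⟩

theorem isBlock_of_vertexOrder {c : SignedTree} (hc : c.ProperSigns) :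
    IsBlock (ULift.{u} (vertexOrder c)) := by
  obtain ⟨s, cs, hs, hcs⟩ := hc
  cases cs with
  | nil =>
    obtain rfl : s = 0 := hs.2 rfl
    have e := vertexOrderLeaf
    exact Or.inl ⟨(ULift.orderIso.trans e).trans (OrderIso.ofUnique _ _)⟩
  | cons c cs =>
    have e := vertexOrderNode s c cs
    have hF := finitelyPresentedOrder_forestOrder fun d hd =>
      (nonempty_vertexOrder_and_finitelyPresented (hcs d hd)).2
    obtain ⟨x⟩ := (nonempty_vertexOrder_and_finitelyPresented (hcs c List.mem_cons_self)).1
    refine Or.inr ⟨ULift.{u} (forestOrder (c :: cs)), inferInstance, hF.ulift,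
      ⟨⟨(forestOrderCons c cs).symm (toLex (.inl x))⟩⟩, ?_⟩
    cases s with
    | zero => exact absurd (hs.1 rfl) (by simp)
    | pos => exact Or.inl ⟨(ULift.orderIso.trans e).trans
        (Prod.Lex.prodLexCongr (OrderIso.refl ℕ) ULift.orderIso.symm)⟩
    | neg => exact Or.inr ⟨(ULift.orderIso.trans e).trans
        (Prod.Lex.prodLexCongr (OrderIso.refl ℕᵒᵈ) ULift.orderIso.symm)⟩

theorem isBlockSum_of_forestOrder {cs : List SignedTree} (h : ∀ c ∈ cs, c.ProperSigns) :
    IsBlockSum cs.length (ULift.{u} (forestOrder cs)) := by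
  induction cs with
  | nil =>
    exact .zero _
  | cons c cs ih =>
    rw [List.forall_mem_cons] at h
    exact .succ (isBlock_of_vertexOrder h.1) (ih h.2)
      (((OrderIso.sumLexCongr ULift.orderIso ULift.orderIso).trans
        (forestOrderCons c cs).symm).trans
          ULift.orderIso.symm)

theorem forestOrder_append (cs ds : List SignedTree) :
    Nonempty (forestOrder cs ⊕ₗ forestOrder ds ≃o forestOrder (cs ++ ds)) := by
  induction cs with
  | nil =>
    exact ⟨OrderIso.emptySumLex⟩
  | cons c cs ih =>
    obtain ⟨e⟩ := ih
    exact ⟨((forestOrderCons c cs).sumLexCongr (OrderIso.refl _)).trans ((OrderIso.sumLexAssoc _ _ _).trans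
      (((OrderIso.refl _).sumLexCongr e).trans (forestOrderCons c (cs ++ ds)).symm))⟩

theorem forestOrder_singleton (c : SignedTree) :
    Nonempty (forestOrder [c] ≃o vertexOrder c) := by
  exact ⟨(forestOrderCons c []).trans OrderIso.sumLexEmpty⟩

theorem properSigns_leaf : (SignedTree.node 0 []).ProperSigns := .node _ _ (by simp) (by simp)

/-- Since `S` is non-empty, the forest has a tree, so a vertex of sign `+` or `-` may be put above
it; without children that sign would be forbidden. -/
theorem exists_vertexOrder_omegaMul {S : Type u} [LinearOrder S] [hS : Nonempty S]
    (h : ∃ cs : List SignedTree, (∀ c ∈ cs, c.ProperSigns) ∧ Nonempty (forestOrder cs ≃o S)) :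
    (∃ c : SignedTree, c.ProperSigns ∧ Nonempty (vertexOrder c ≃o ℕ ×ₗ S)) ∧
      ∃ c : SignedTree, c.ProperSigns ∧ Nonempty (vertexOrder c ≃o ℕᵒᵈ ×ₗ S) := by
  obtain ⟨_ | ⟨c, cs⟩, hcs, ⟨e⟩⟩ := h
  · exact isEmptyElim (e.symm hS.some)
  · have f := vertexOrderNode .pos c cs
    have g := vertexOrderNode .neg c cs
    exact ⟨⟨.node .pos (c :: cs), .node _ _ ⟨nofun, nofun⟩ hcs,
        ⟨f.trans (Prod.Lex.prodLexCongr (OrderIso.refl ℕ) e)⟩⟩,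
      ⟨.node .neg (c :: cs), .node _ _ ⟨nofun, nofun⟩ hcs,
        ⟨g.trans (Prod.Lex.prodLexCongr (OrderIso.refl ℕᵒᵈ) e)⟩⟩⟩

/-- Every finitely presented order is presented by a forest. -/
theorem FinitelyPresentedOrder.exists_forestOrder {L : Type u} [LinearOrder L]
    (h : FinitelyPresentedOrder L) :
    ∃ cs : List SignedTree, (∀ c ∈ cs, c.ProperSigns) ∧ Nonempty (forestOrder cs ≃o L) := by
  have empty : ∀ (E : Type u) [LinearOrder E] [IsEmpty E],
      ∃ cs : List SignedTree, (∀ c ∈ cs, c.ProperSigns) ∧ Nonempty (forestOrder cs ≃o E) := by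
    intro E _ _
    exact ⟨[], by simp, ⟨forestOrderNil.trans (Equiv.equivOfIsEmpty PEmpty.{1} E |>.toOrderIso
      (fun x => x.elim) (fun x => isEmptyElim x))⟩⟩
  have single : ∀ {E : Type u} [LinearOrder E],
      (∃ c : SignedTree, c.ProperSigns ∧ Nonempty (vertexOrder c ≃o E)) →
      ∃ cs : List SignedTree, (∀ c ∈ cs, c.ProperSigns) ∧ Nonempty (forestOrder cs ≃o E) := by
    rintro E _ ⟨c, hc, ⟨e⟩⟩
    obtain ⟨f⟩ := forestOrder_singleton c
    exact ⟨[c], by simpa using hc, ⟨f.trans e⟩⟩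
  induction h with
  | zero => exact empty _
  | one =>
    have e := vertexOrderLeaf
    exact single ⟨_, properSigns_leaf, ⟨e.trans (OrderIso.ofUnique _ _)⟩⟩
  | sum _ _ ih₁ ih₂ =>
    obtain ⟨cs, hcs, ⟨e⟩⟩ := ih₁
    obtain ⟨ds, hds, ⟨f⟩⟩ := ih₂
    obtain ⟨g⟩ := forestOrder_append cs ds
    exact ⟨cs ++ ds, fun c hc => (List.mem_append.1 hc).elim (hcs c) (hds c),
      ⟨g.symm.trans (e.sumLexCongr f)⟩⟩
  | @omegaMul S _ _ ih =>
    rcases isEmpty_or_nonempty S with hS | hS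
    · have : IsEmpty (ℕ ×ₗ S) := ⟨fun x => isEmptyElim (ofLex x).2⟩
      exact empty _
    · exact single (exists_vertexOrder_omegaMul ih).1
  | @omegaStarMul S _ _ ih =>
    rcases isEmpty_or_nonempty S with hS | hS
    · have : IsEmpty (ℕᵒᵈ ×ₗ S) := ⟨fun x => isEmptyElim (ofLex x).2⟩
      exact empty _
    · exact single (exists_vertexOrder_omegaMul ih).2
  | iso _ e ih =>
    obtain ⟨cs, hcs, ⟨f⟩⟩ := ih
    exact ⟨cs, hcs, ⟨f.trans e⟩⟩

theorem IsBlock.exists_vertexOrder {L : Type u} [LinearOrder L] (h : IsBlock L) :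
    ∃ c : SignedTree, c.ProperSigns ∧ Nonempty (vertexOrder c ≃o L) := by
  rcases h with ⟨⟨e⟩⟩ | ⟨S, _, hS, _, ⟨⟨e⟩⟩ | ⟨⟨e⟩⟩⟩
  · have f := vertexOrderLeaf
    exact ⟨_, properSigns_leaf, ⟨f.trans ((OrderIso.ofUnique _ _).trans e.symm)⟩⟩
  · obtain ⟨c, hc, ⟨f⟩⟩ := (exists_vertexOrder_omegaMul hS.exists_forestOrder).1
    exact ⟨c, hc, ⟨f.trans e.symm⟩⟩
  · obtain ⟨c, hc, ⟨f⟩⟩ := (exists_vertexOrder_omegaMul hS.exists_forestOrder).2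
    exact ⟨c, hc, ⟨f.trans e.symm⟩⟩

theorem IsBlockSum.exists_forestOrder {n : ℕ} {L : Type u} [LinearOrder L] (h : IsBlockSum n L) :
    ∃ cs : List SignedTree, cs.length = n ∧ (∀ c ∈ cs, c.ProperSigns) ∧
      Nonempty (forestOrder cs ≃o L) := by
  induction h with
  | zero L =>
    exact ⟨[], rfl, by simp, ⟨forestOrderNil.trans (Equiv.equivOfIsEmpty PEmpty.{1} L |>.toOrderIso
      (fun x => x.elim) (fun x => isEmptyElim x))⟩⟩
  | succ hA _ f ih =>
    obtain ⟨c, hc, ⟨e₁⟩⟩ := hA.exists_vertexOrder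
    obtain ⟨cs, rfl, hcs, ⟨e₂⟩⟩ := ih
    exact ⟨c :: cs, rfl, List.forall_mem_cons.2 ⟨hc, hcs⟩,
      ⟨((forestOrderCons c cs).trans (e₁.sumLexCongr e₂)).trans f⟩⟩

theorem IsBlockSum.exists_threeSignedTree {n : ℕ} {L : Type u} [LinearOrder L] (h : IsBlockSum n L) :
    ∃ T : ThreeSignedTree, T.rootWidth = n ∧ Nonempty (T.lin ≃o L) := by
  obtain ⟨cs, rfl, hcs, ⟨e⟩⟩ := h.exists_forestOrder
  refine ⟨⟨.node 0 cs, rfl, hcs⟩, rfl, ?_⟩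
  cases cs with
  | nil =>
    exact ⟨(LinOrd.orderIsoOfEq (Y := LinOrd.of PEmpty.{1})
      (by simp [ThreeSignedTree.lin, SignedTree.children])).trans (forestOrderNil.symm.trans e)⟩
  | cons c cs =>
    have f := vertexOrderNode 0 c cs
    have g : omegaPow 0 ×ₗ forestOrder (c :: cs) ≃o forestOrder (c :: cs) :=
      Prod.Lex.uniqueProd PUnit.{1} _
    exact ⟨(LinOrd.orderIsoOfEq (by simp [ThreeSignedTree.lin, SignedTree.children])).trans
      ((f.trans g).trans e)⟩

theorem ThreeSignedTree.isBlockSum (T : ThreeSignedTree) :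
    IsBlockSum T.rootWidth (ULift.{u} T.lin) := by
  obtain ⟨⟨s, cs⟩, hs, hcs⟩ := T
  change s = 0 at hs
  subst hs
  have h := isBlockSum_of_forestOrder.{u} hcs
  cases cs with
  | nil =>
    have e : ThreeSignedTree.lin ⟨.node 0 [], rfl, hcs⟩ ≃o forestOrder [] :=
      LinOrd.orderIsoOfEq (by simp [ThreeSignedTree.lin, SignedTree.children, forestOrder])
    exact h.iso ((ULift.orderIso.trans e.symm).trans ULift.orderIso.symm)
  | cons c cs =>
    have f := vertexOrderNode 0 c cs
    have g : omegaPow 0 ×ₗ forestOrder (c :: cs) ≃o forestOrder (c :: cs) :=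
      Prod.Lex.uniqueProd PUnit.{1} _
    have e : ThreeSignedTree.lin ⟨.node 0 (c :: cs), rfl, hcs⟩ ≃o vertexOrder (.node 0 (c :: cs)) :=
      LinOrd.orderIsoOfEq (by simp [ThreeSignedTree.lin, SignedTree.children])
    exact h.iso ((ULift.orderIso.trans ((e.trans f).trans g).symm).trans ULift.orderIso.symm)

/-- Blocks are the orders presented at the children of the root, so the bounds on the width can be
proved without trees. -/
theorem orderWidth_eq_sInf_isBlockSum (L : Type u) [LinearOrder L] :
    orderWidth L = sInf {n | IsBlockSum n L} := by
  unfold orderWidth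
  congr 1
  ext n
  refine ⟨?_, fun h => h.exists_threeSignedTree⟩
  rintro ⟨T, rfl, ⟨e⟩⟩
  exact T.isBlockSum.iso (ULift.orderIso.trans e)

theorem orderWidth_congr {L : Type u} {L' : Type v} [LinearOrder L] [LinearOrder L']
    (e : L ≃o L') : orderWidth L = orderWidth L' := by
  unfold orderWidth
  congr 1
  ext n
  exact exists_congr fun T => and_congr_right fun _ =>
    ⟨fun ⟨f⟩ => ⟨f.trans e⟩, fun ⟨f⟩ => ⟨f.trans e.symm⟩⟩

theorem IsBlockSum.orderWidth_le {n : ℕ} {L : Type u} [LinearOrder L] (h : IsBlockSum n L) :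
    orderWidth L ≤ n := by
  rw [orderWidth_eq_sInf_isBlockSum]
  exact Nat.sInf_le h

/-- Some forest presents `L`, so the infimum is attained and is not the default value of `sInf ∅`.
-/
theorem FinitelyPresentedOrder.isBlockSum_orderWidth {L : Type u} [LinearOrder L]
    (h : FinitelyPresentedOrder L) : IsBlockSum (orderWidth L) L := by
  rw [orderWidth_eq_sInf_isBlockSum]
  obtain ⟨cs, hcs, ⟨e⟩⟩ := h.exists_forestOrder
  exact Nat.sInf_mem (s := {n | IsBlockSum n L})
    ⟨cs.length, (isBlockSum_of_forestOrder hcs).iso (ULift.orderIso.trans e)⟩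

theorem orderWidth_of_isEmpty (L : Type u) [LinearOrder L] [IsEmpty L] : orderWidth L = 0 :=
  Nat.le_zero.1 (IsBlockSum.zero L).orderWidth_le

theorem FinitelyPresentedOrder.orderWidth_pos {L : Type u} [LinearOrder L] [Nonempty L]
    (h : FinitelyPresentedOrder L) : 0 < orderWidth L := h.isBlockSum_orderWidth.pos

/-- If a finitely presented order is cut into two non-empty orders of the same rank, then one of
the parts has smaller width. -/
theorem min_orderWidth_lt {L A B : Type u} [LinearOrder L] [LinearOrder A] [LinearOrder B]
    [Nonempty A] [Nonempty B] (hL : FinitelyPresentedOrder L) (e : A ⊕ₗ B ≃o L)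
    (h : ∀ α, FiniteCondensation A α ↔ FiniteCondensation B α) :
    min (orderWidth A) (orderWidth B) < orderWidth L := by
  rcases hL.isBlockSum_orderWidth.cut e with ⟨q, -, hq, hlt | ⟨α, hα, hα'⟩⟩ |
    ⟨p, -, hp, hlt | ⟨α, hα, hα'⟩⟩
  · exact min_lt_of_right_lt (hq.orderWidth_le.trans_lt hlt)
  · exact (hα' ((h α).1 hα)).elim
  · exact min_lt_of_left_lt (hp.orderWidth_le.trans_lt hlt)
  · exact (hα' ((h α).2 hα)).elim

/-- The width of `k × A + B` with `k ≥ 1` exceeds the minimum of the widths of `A` and `B`, if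
`A` has the same rank as the prefix `B` of `A`. -/
theorem min_orderWidth_lt_firstCopiesAdd {A : Type u} [LinearOrder A] {B : Set A}
    (hA : FinitelyPresentedOrder A) (hB : FinitelyPresentedOrder B) (hBl : IsLowerSet B)
    [Nonempty B] (h : ∀ α, FiniteCondensation A α ↔ FiniteCondensation B α) (k : ℕ) :
    min (orderWidth A) (orderWidth B) < orderWidth (firstCopiesAdd (k + 1) B) := by
  have : Nonempty A := ⟨(Classical.arbitrary B).1⟩
  induction k with
  | zero =>
    exact min_orderWidth_lt (hA.firstCopiesAdd hB 1)
      (((OrderIso.refl A).sumLexCongr (firstCopiesAddZero B)).trans (firstCopiesAddSucc 0 B)) h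
  | succ k ih =>
    have hne : Nonempty (firstCopiesAdd (k + 1) B) :=
      ⟨⟨toLex (0, Classical.arbitrary A), Or.inl (Nat.succ_pos k)⟩⟩
    -- Cut behind the first copy of `A`: the remainder has the rank of `A`, as it contains at least
    -- one copy. If the remainder is the narrower part, the induction hypothesis applies to it.
    have := min_orderWidth_lt (hA.firstCopiesAdd hB (k + 2)) (firstCopiesAddSucc (k + 1) B)
      fun α => ⟨fun hα => hα.finitelyManyCopies _ hBl, fun hα =>
        (finiteCondensation_sum_iff.1 (hα.of_orderIso (firstCopiesAddSucc k B))).1⟩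
    rcases min_lt_iff.1 this with h' | h'
    · exact min_lt_of_left_lt h'
    · exact ih.trans h'

end Trees

-- Comparing prefixes by rank.

section EuclideanDivision

theorem isLowerSet_firstCopies {L : Type v} [LinearOrder L] (k : ℕ) :
    IsLowerSet (firstCopies L k) :=
  fun _ _ h hx => (Prod.Lex.monotone_fst _ _ h).trans_lt hx

theorem firstCopiesAdd_empty (L : Type u) [LinearOrder L] (k : ℕ) :
    firstCopiesAdd k (∅ : Set L) = firstCopies L k := by
  ext x
  simp [firstCopiesAdd, firstCopies]

/-- `ω × L` without its first copy of `L` is isomorphic to `ω × L`. -/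
noncomputable def firstCopyCompl (L : Type u) [LinearOrder L] :
    ((firstCopies L 1)ᶜ : Set (ℕ ×ₗ L)) ≃o ℕ ×ₗ L :=
  (OrderIso.setCongr _ _ (congrArg _ (firstCopiesAdd_empty L 1).symm)).trans
    ((firstCopiesAddCompl 1 ∅).symm.trans
      (((OrderIso.setCongr _ _ Set.compl_empty).trans OrderIso.Set.univ).sumLexCongr
        (OrderIso.refl _) |>.trans (addOmegaMul L)))

/-- The first copy of `L` in `ω × L`. -/
noncomputable def firstCopyIso (L : Type u) [LinearOrder L] : firstCopies L 1 ≃o L :=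
  StrictMono.orderIsoOfSurjective (fun x => (ofLex x.1).2)
    (by
      rintro ⟨x, hx⟩ ⟨y, hy⟩ h
      have hx : (ofLex x).1 < 1 := hx
      have hy : (ofLex y).1 < 1 := hy
      rcases Prod.Lex.lt_iff.1 h with h | h
      · simp only at h
        omega
      · exact h.2)
    (fun a => ⟨⟨toLex (0, a), Nat.zero_lt_one⟩, rfl⟩)

/-- If `ω × A` and `B` are prefixes of the same order and the rank of `B` exceeds that of `A`,
then `ω × A` is a prefix of `B`. -/
theorem omegaMul_initialSeg_of_rank_lt {A B X : Type u} [LinearOrder A] [LinearOrder B]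
    [LinearOrder X] (f : (ℕ ×ₗ A) ≤i X) (g : B ≤i X)
    (h : ∃ α, FiniteCondensation A α ∧ ¬ FiniteCondensation B α) : Nonempty ((ℕ ×ₗ A) ≤i B) := by
  obtain ⟨α, hα, hα'⟩ := h
  rcases initialSeg_trichotomy f g with ⟨⟨e⟩⟩ | ⟨k, -⟩ | ⟨k, hk⟩
  · exact ⟨e.toInitialSeg⟩
  · exact ⟨k⟩
  · exact (hα' (hα.of_initialSeg_omegaMul k hk)).elim

/-- If `ω × A` and `ω × B` are prefixes of the same order and `A` and `B` are non-empty orders of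
the same rank, then `ω × A` and `ω × B` are isomorphic. -/
theorem omegaMul_iso_of_rank_eq {A B X : Type u} [LinearOrder A] [LinearOrder B]
    [LinearOrder X] [Nonempty A] [Nonempty B] (f : (ℕ ×ₗ A) ≤i X) (g : (ℕ ×ₗ B) ≤i X)
    (hA : ∃ α, FiniteCondensation A α)
    (h : ∀ α, FiniteCondensation A α ↔ FiniteCondensation B α) :
    Nonempty ((ℕ ×ₗ A) ≃o (ℕ ×ₗ B)) := by
  -- If one of the two were a proper prefix of the other, its rank would be at most the common rank
  -- of `A` and `B`, which it exceeds.
  rcases initialSeg_trichotomy f g with he | ⟨k, hk⟩ | ⟨k, hk⟩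
  · exact he
  · obtain ⟨α, hα, hα'⟩ := exists_not_finiteCondensation_omegaMul hA
    exact (hα' (((h α).1 hα).of_initialSeg_omegaMul k hk)).elim
  · obtain ⟨α, hα, hα'⟩ := exists_not_finiteCondensation_omegaMul (hA.imp fun α => (h α).1)
    exact (hα' (((h α).2 hα).of_initialSeg_omegaMul k hk)).elim

end EuclideanDivision

-- The division itself.

theorem mainTheorem3 {L : Type u} {L' : Type v} [LinearOrder L] [LinearOrder L']
    (hL : FinitelyPresentedOrder L) (hL' : FinitelyPresentedOrder L')
    (f : (ℕ ×ₗ L) ≃o (ℕ ×ₗ L'))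
    (hf : IsPrefixOf (f '' firstCopies L 1) (firstCopies L' 1)) :
    ∃ (k : ℕ) (L₁ L₂ : Set L),
      1 ≤ k ∧
      FinitelyPresentedOrder L₁ ∧ FinitelyPresentedOrder L₂ ∧
      (IsLowerSet L₁ ∧ L₂ = L₁ᶜ) ∧
      f '' firstCopiesAdd k L₁ = firstCopies L' 1 ∧
      Nonempty ((ℕ ×ₗ (L₁ ⊕ₗ L₂)) ≃o (ℕ ×ₗ (L₂ ⊕ₗ L₁))) ∧
      (hausdorffRank L₁ < hausdorffRank L₂ → Nonempty ((ℕ ×ₗ L₁) ≤i L₂)) ∧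
      (hausdorffRank L₂ < hausdorffRank L₁ → Nonempty ((ℕ ×ₗ L₂) ≤i L₁)) ∧
      (hausdorffRank L₁ = hausdorffRank L₂ →
        (L₁.Nonempty → L₂.Nonempty → Nonempty ((ℕ ×ₗ L₁) ≃o (ℕ ×ₗ L₂))) ∧
        (Nonempty L →
          min (orderWidth L₁) (orderWidth L₂) < min (orderWidth L) (orderWidth L'))) := by
  -- An empty `ω × L` has no proper lower set to cut at, so this case is settled separately; no rank
  -- inequality can hold there.
  rcases isEmpty_or_nonempty L with hE | hne
  · have hX : IsEmpty (ℕ ×ₗ L) := ⟨fun x => isEmptyElim (ofLex x).2⟩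
    have hX' : IsEmpty (ℕ ×ₗ L') := f.symm.toEquiv.isEmpty
    have hlt : ∀ S T : Set L, ¬ hausdorffRank S < hausdorffRank T := fun S T h => by
      obtain ⟨α, -, hα⟩ := exists_finiteCondensation_of_hausdorffRank_lt h
      exact hα finiteCondensation_of_finite
    refine ⟨1, ∅, ∅ᶜ, le_rfl, .of_isEmpty _, .of_isEmpty _, ⟨isLowerSet_empty, rfl⟩,
      Subsingleton.elim _ _, ⟨(omegaMulRotate _ _).symm.trans ?_⟩, fun h => (hlt _ _ h).elim,
      fun h => (hlt _ _ h).elim, fun _ => ⟨fun h => (Set.not_nonempty_empty h).elim,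
        fun h => (not_isEmpty_of_nonempty L hE).elim⟩⟩
    exact OrderIso.emptySumLex
  have hne' : Nonempty L' := hne.elim fun a => ⟨(ofLex (f (toLex (0, a)))).2⟩
  have hU : IsLowerSet (f ⁻¹' firstCopies L' 1) :=
    (isLowerSet_firstCopies 1).preimage f.monotone
  have hU' : f ⁻¹' firstCopies L' 1 ≠ Set.univ := by
    intro h
    obtain ⟨b⟩ := hne'
    have hb : f.symm (toLex (1, b)) ∈ f ⁻¹' firstCopies L' 1 := h ▸ trivial
    simp [firstCopies] at hb
  obtain ⟨k, L₁, hL₁, hL₁', hk⟩ := exists_eq_firstCopiesAdd hU hU'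
  -- For `k = 0` the hypothesis on `f` would put the whole first copy of `L` into `L₁`, which is
  -- proper.
  have hk1 : 1 ≤ k := by
    by_contra hk0
    obtain rfl : k = 0 := by omega
    refine hL₁' (Set.eq_univ_of_forall fun a => ?_)
    have : toLex (0, a) ∈ f ⁻¹' firstCopies L' 1 := hf.1 ⟨_, Nat.zero_lt_one, rfl⟩
    rw [hk] at this
    exact (this.resolve_left (Nat.not_lt_zero _)).2
  have himage : f '' firstCopiesAdd k L₁ = firstCopies L' 1 := by
    rw [← hk, Set.image_preimage_eq _ f.surjective]
  obtain ⟨hF₁, hF₂⟩ := hL.cut (lowerSetSumCompl L₁ hL₁)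
  have split : (ℕ ×ₗ (L₁ ⊕ₗ (L₁ᶜ : Set L))) ≃o ℕ ×ₗ L :=
    Prod.Lex.prodLexCongr (OrderIso.refl ℕ) (lowerSetSumCompl L₁ hL₁)
  -- Both sides are what remains when the first copy of `L'` is removed from `ω × L'`, up to
  -- isomorphism.
  have absorb₂ : (L₁ᶜ : Set L) ⊕ₗ (ℕ ×ₗ L) ≃o ℕ ×ₗ L :=
    (firstCopiesAddCompl k L₁).trans ((OrderIso.setCongr _ _ (congrArg _ hk.symm)).trans
      ((preimageIso f (firstCopies L' 1)ᶜ).trans ((firstCopyCompl L').trans f.symm)))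
  have swap : (ℕ ×ₗ ((L₁ᶜ : Set L) ⊕ₗ L₁)) ≃o ℕ ×ₗ L :=
    (omegaMulRotate _ _).symm.trans (((OrderIso.refl _).sumLexCongr split).trans absorb₂)
  have absorb₁ : L₁ ⊕ₗ (ℕ ×ₗ L) ≃o ℕ ×ₗ L :=
    ((OrderIso.refl _).sumLexCongr swap.symm).trans ((omegaMulRotate _ _).trans split)
  obtain ⟨g₁⟩ := omegaMul_initialSeg_of_absorb absorb₁
  obtain ⟨g₂⟩ := omegaMul_initialSeg_of_absorb absorb₂
  refine ⟨k, L₁, L₁ᶜ, hk1, hF₁, hF₂, ⟨hL₁, rfl⟩, himage, ⟨split.trans swap.symm⟩,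
    fun h => omegaMul_initialSeg_of_rank_lt g₁ (sumLexInitialSeg absorb₂)
      (exists_finiteCondensation_of_hausdorffRank_lt h),
    fun h => omegaMul_initialSeg_of_rank_lt g₂ (sumLexInitialSeg absorb₁)
      (exists_finiteCondensation_of_hausdorffRank_lt h), fun h => ?_⟩
  have hrank : ∀ α, FiniteCondensation L₁ α ↔ FiniteCondensation (L₁ᶜ : Set L) α := fun α => by
    rw [← hausdorffRank_le_iff, h, hausdorffRank_le_iff]
  refine ⟨fun h₁ h₂ => ?_, fun _ => ?_⟩
  · have := h₁.to_subtype
    have := h₂.to_subtype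
    exact omegaMul_iso_of_rank_eq g₁ g₂ hF₁.exists_finiteCondensation hrank
  rcases isEmpty_or_nonempty L₁ with h₁ | h₁
  · rw [orderWidth_of_isEmpty L₁, Nat.zero_min]
    exact lt_min hL.orderWidth_pos hL'.orderWidth_pos
  rcases isEmpty_or_nonempty (L₁ᶜ : Set L) with h₂ | h₂
  · rw [orderWidth_of_isEmpty (L₁ᶜ : Set L), Nat.min_zero]
    exact lt_min hL.orderWidth_pos hL'.orderWidth_pos
  have hltL := min_orderWidth_lt hL (lowerSetSumCompl L₁ hL₁) hrank
  refine lt_min hltL ?_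
  have e : firstCopiesAdd k L₁ ≃o L' :=
    (OrderIso.setCongr _ _ hk.symm).trans ((preimageIso f (firstCopies L' 1)).trans
      (firstCopyIso L'))
  obtain ⟨n, rfl⟩ := Nat.exists_eq_add_of_le' hk1
  -- As `L₁` and `L₂` have equal rank, `L = L₁ + L₂` has the rank of `L₁`. The bound obtained
  -- involves the width of `L` instead of `L₂`; `hltL` corrects this.
  have hlt := min_orderWidth_lt_firstCopiesAdd hL hF₁ hL₁ (fun α =>
    ⟨fun hα => (finiteCondensation_sum_iff.1 (hα.of_orderIso (lowerSetSumCompl L₁ hL₁))).1,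
      fun hα => (finiteCondensation_sum_iff.2 ⟨hα, (hrank α).1 hα⟩).of_orderIso
        (lowerSetSumCompl L₁ hL₁).symm⟩) n
  rw [orderWidth_congr e] at hlt
  rcases min_lt_iff.1 hlt with h' | h'
  · exact hltL.trans h'
  · exact min_lt_of_left_lt h'
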